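/- Lemma 4.2. Let $d\ge 3$ and $\mathbb I=[0,1]$. A $d$-dimensional copula is a function $C:\mathbb I^d\to\mathbb R$ of the form $C(\mathbf x)=\mu_C([\mathbf 0,\mathbf x])$, where $\mu_C$ is a probability measure on $\mathbb I^d$ with uniform univariate marginals. A (normalized) generator is a continuous, non-increasing function $\psi:[0,\infty)\to\mathbb I$ with $\psi(0)=1$, $\lim_{z\to\infty}\psi(z)=0$, $\psi(1)=\tfrac12$, which, extended by $\psi(\infty)=0$, is strictly decreasing on $[0,\varphi(0)]$; here $\varphi(x)=\inf\{z\in[0,\infty]:\psi(z)=x\}$ for $x\in\mathbb I$. The copula $C$ is Archimedean with generator $\psi$ if $C(\mathbf x)=\psi(\varphi(x_1)+\dots+\varphi(x_d))$ for all $\mathbf x\in\mathbb I^d$. A $1$-Markov kernel of $C$ is a Markov kernel $K$ from $\mathbb I$ to $\mathbb I^{d-1}$ that is a regular conditional distribution of $(X_2,\dots,X_d)$ given $X_1$ when $(X_1,\dots,X_d)\sim\mu_C$. Let $C,C_1,C_2,\dots$ be $d$-dimensional Archimedean copulas with generators $\psi,\psi_1,\psi_2,\dots$, and suppose that $C_n\to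 C$ uniformly on $\mathbb I^d$. Let $K_\psi$ be the version of the $1$-Markov kernel of $C$ given by $$K_\psi\Big(x_1,\prod_{i=2}^d[0,x_i]\Big)=\begin{cases}1,&x_1\in\{0,1\},\\ 0,&x_1\in(0,1),\ (x_1,\dots,x_d)\in\operatorname{int}L_0,\\ \dfrac{\psi'\big(\sum_{i=1}^d\varphi(x_i)\big)}{\psi'(\varphi(x_1))},&x_1\in(0,1),\ (x_1,\dots,x_d)\notin\operatorname{int}L_0,\end{cases}$$ where $L_0=\{\mathbf x\in\mathbb I^d: C(\mathbf x)=0\}$, the interior is taken in $\mathbb I^d$, and $\psi'(\infty)=0$; let $K_1,K_2,\dots$ be the corresponding versions for $C_1,C_2,\dots$. Then these kernels exist (that is, these formulas do define versions of the $1$-Markov kernels of $C,C_1,C_2,\dots$), and for every $x_1\in(0,1)$ and every $(x_2,\dots,x_d)\in\mathbb I^{d-1}$ $$\lim_{n\to\infty}K_n\Big(x_1,\prod_{i=2}^d[0,x_i]\Big)=K_\psi\Big(x_1,\prod_{i=2}^d[0,x_i]\Big).$$ -/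

import Mathlib

open Set Filter Topology MeasureTheory ProbabilityTheory unitInterval
open scoped ENNReal

noncomputable section

/-- The extension of a generator to `[0, ∞]` by `ψ(∞) = 0`. (A generator is a function on `[0, ∞)`;
it is represented by a function on `ℝ` whose values at negative arguments are never used.) -/
def genExt (ψ : ℝ → ℝ) (z : ℝ≥0∞) : ℝ :=
  if z = ∞ then 0 else ψ z.toReal

/-- The pseudoinverse `φ` of a generator: `φ(x) = inf {z ∈ [0, ∞] : ψ(z) = x}`, where `ψ(∞) = 0`.
In particular `φ(0) = inf {z ∈ [0, ∞] : ψ(z) = 0}`, which may be `∞`. -/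
def pseudoInv (ψ : ℝ → ℝ) (x : ℝ) : ℝ≥0∞ :=
  sInf {z : ℝ≥0∞ | genExt ψ z = x}

/-- The first derivative of a generator, extended by `ψ'(∞) = 0`. -/
def genDeriv (ψ : ℝ → ℝ) (z : ℝ≥0∞) : ℝ :=
  if z = ∞ then 0 else deriv ψ z.toReal

/-- Normalized Archimedean generators. -/
structure IsGenerator (ψ : ℝ → ℝ) : Prop where
  mapsTo : MapsTo ψ (Ici 0) (Icc 0 1)
  continuousOn : ContinuousOn ψ (Ici 0)
  antitoneOn : AntitoneOn ψ (Ici 0)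
  map_zero : ψ 0 = 1
  tendsto_zero : Tendsto ψ atTop (𝓝 0)
  strictAntiOn : StrictAntiOn (genExt ψ) (Iic (pseudoInv ψ 0))
  normalized : ψ 1 = 1 / 2

/-- `μ` is the `d`-stochastic measure of `C`: it is a probability measure on `𝕀^d` with uniform
univariate marginals, and `μ([0, x]) = C(x)` for all `x ∈ 𝕀^d`. -/
structure IsStochasticMeasureOf {d : ℕ} (μ : Measure (Fin d → I)) (C : (Fin d → I) → ℝ) :
    Prop where
  isProbabilityMeasure : IsProbabilityMeasure μ
  map_eval : ∀ i : Fin d, μ.map (fun x => x i) = volume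
  real_Iic : ∀ x : Fin d → I, μ.real (Iic x) = C x

/-- `C` is a `d`-dimensional copula: the restriction to `𝕀^d` of the distribution function of a
probability measure on `𝕀^d` with uniform univariate marginals. -/
def IsCopula {d : ℕ} (C : (Fin d → I) → ℝ) : Prop :=
  ∃ μ : Measure (Fin d → I), IsStochasticMeasureOf μ C

/-- `C` is a `d`-dimensional Archimedean copula with (normalized) generator `ψ`, i.e. it is a copula
and `C(x) = ψ(φ(x₁) + ⋯ + φ(x_d))`. -/
structure IsArchimedeanCopula {d : ℕ} (C : (Fin d → I) → ℝ) (ψ : ℝ → ℝ) : Prop where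
  isCopula : IsCopula C
  isGenerator : IsGenerator ψ
  eq_gen : ∀ x : Fin d → I, C x = genExt ψ (∑ i, pseudoInv ψ (x i))

/-- `K` is (a version of) the `1`-Markov kernel of the copula `C`: a Markov kernel from `𝕀` to
`𝕀^m`, `m = d - 1`, that is a regular conditional distribution of the last `m` coordinates given the
first one, under the measure of `C`. -/
def IsOneMarkovKernel {m : ℕ} (K : Kernel I (Fin m → I)) (C : (Fin (m + 1) → I) → ℝ) : Prop :=
  IsMarkovKernel K ∧ ∃ μ : Measure (Fin (m + 1) → I), IsStochasticMeasureOf μ C ∧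
    HasCondDistrib (fun x : Fin (m + 1) → I => Fin.tail x) (fun x => x 0) K μ

/-- The zero set `L₀` of a copula. -/
def zeroSet {d : ℕ} (C : (Fin d → I) → ℝ) : Set (Fin d → I) :=
  {x | C x = 0}

open Classical in
/-- The value `K_ψ(x₁, [0, y])` of the distinguished version of the `1`-Markov kernel of the
Archimedean copula `C` with generator `ψ`. -/
def archKernelCDF {m : ℕ} (C : (Fin (m + 1) → I) → ℝ) (ψ : ℝ → ℝ) (x₁ : I) (y : Fin m → I) : ℝ :=
  if x₁ = 0 ∨ x₁ = 1 then 1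
  else if (Fin.cons x₁ y : Fin (m + 1) → I) ∈ interior (zeroSet C) then 0
  else genDeriv ψ (pseudoInv ψ x₁ + ∑ j, pseudoInv ψ (y j)) / genDeriv ψ (pseudoInv ψ x₁)

/-- `K` is the version `K_ψ` of the `1`-Markov kernel of `C`. -/
structure IsArchKernel {m : ℕ} (K : Kernel I (Fin m → I)) (C : (Fin (m + 1) → I) → ℝ)
    (ψ : ℝ → ℝ) : Prop where
  isOneMarkovKernel : IsOneMarkovKernel K C
  real_Iic : ∀ (x₁ : I) (y : Fin m → I), (K x₁).real (Iic y) = archKernelCDF C ψ x₁ y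

end

/-! Measure each coordinate by its level `s = φ(x)`: the event `Xᵢ ≤ ψ(sᵢ) for all i` has
probability `ψ(∑ sᵢ)`.

Regularity of `ψ`. Inclusion–exclusion on two coordinates makes `ψ` convex; on the part of the space
where a third coordinate exceeds `ψ(h)` it makes `ψ - ψ(· + h)` convex. Where `ψ` is differentiable,
both convex summands of `ψ = ψ(· + h) + (ψ - ψ(· + h))` are, so differentiability spreads from one
point to all larger ones (`IsArchimedeanCopula.isConvexGenerator`). This is where `d ≥ 3` enters.

Existence of the kernels. The quotient is the `x₁`-derivative of `C`, so integrating it recovers `C`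
and it agrees with a regular conditional distribution for almost every `x₁`. For any other `x₁`,
choose a good `x₀ > x₁`; conditioning on one coordinate and lowering its level turns the law at
`φ(x₀)` into the law at `φ(x₁)` (`exists_measure_shift`). No higher monotonicity of `ψ` is needed.

Convergence. The normalization at `1`, together with halving and addition of levels, gives `ψₙ → ψ`
at dyadic points, then everywhere by monotonicity (`tendsto_genExt`). Hence `φₙ → φ` away from `0`,
and convexity upgrades this to convergence of derivatives at moving points
(`tendsto_deriv_of_convexOn`). -/

namespace IsGenerator

/-! ### Generators and their pseudoinverses on `[0, ∞]` -/

variable {ψ : ℝ → ℝ}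

lemma genExt_top (ψ : ℝ → ℝ) : genExt ψ ∞ = 0 := if_pos rfl

lemma genExt_of_ne_top (ψ : ℝ → ℝ) {z : ℝ≥0∞} (hz : z ≠ ∞) : genExt ψ z = ψ z.toReal := if_neg hz

lemma genExt_ofReal (ψ : ℝ → ℝ) {z : ℝ} (hz : 0 ≤ z) : genExt ψ (ENNReal.ofReal z) = ψ z := by
  rw [genExt_of_ne_top ψ ENNReal.ofReal_ne_top, ENNReal.toReal_ofReal hz]

lemma genExt_zero (h : IsGenerator ψ) : genExt ψ 0 = 1 := by
  simp [genExt, h.map_zero]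

lemma genExt_mem (h : IsGenerator ψ) (z : ℝ≥0∞) : genExt ψ z ∈ Icc (0 : ℝ) 1 := by
  unfold genExt
  split_ifs
  · simp
  · exact h.mapsTo ENNReal.toReal_nonneg

lemma antitone_genExt (h : IsGenerator ψ) : Antitone (genExt ψ) := by
  intro a b hab
  rcases eq_or_ne b ∞ with rfl | hb
  · rw [genExt_top]; exact (h.genExt_mem a).1
  · rw [genExt_of_ne_top ψ hb, genExt_of_ne_top ψ (ne_top_of_le_ne_top hb hab)]
    exact h.antitoneOn ENNReal.toReal_nonneg ENNReal.toReal_nonneg (ENNReal.toReal_mono hb hab)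

lemma continuous_genExt (h : IsGenerator ψ) : Continuous (genExt ψ) := by
  rw [continuous_iff_continuousAt]
  intro z
  rcases eq_or_ne z ∞ with rfl | hz
  · rw [ContinuousAt, genExt_top, tendsto_order]
    refine ⟨fun a ha => Eventually.of_forall fun z => ha.trans_le (h.genExt_mem z).1,
      fun a ha => ?_⟩
    obtain ⟨N, hN⟩ := ((tendsto_order.1 h.tendsto_zero).2 a ha).exists_forall_of_atTop
    refine ENNReal.nhds_top_basis.eventually_iff.2
      ⟨ENNReal.ofReal N, ENNReal.ofReal_lt_top, fun z hz => ?_⟩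
    rcases eq_or_ne z ∞ with rfl | hz'
    · rwa [genExt_top]
    · rw [genExt_of_ne_top ψ hz']
      exact hN _ ((ENNReal.ofReal_le_iff_le_toReal hz').1 (le_of_lt hz))
  · have h1 : ContinuousOn (fun z : ℝ≥0∞ => ψ z.toReal) {z | z ≠ ∞} :=
      h.continuousOn.comp ENNReal.continuousOn_toReal fun z _ => ENNReal.toReal_nonneg
    have h2 : ContinuousOn (genExt ψ) {z | z ≠ ∞} :=
      h1.congr fun z hz => genExt_of_ne_top ψ hz
    exact h2.continuousAt (isOpen_ne.mem_nhds hz)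

lemma genExt_pseudoInv (h : IsGenerator ψ) {y : ℝ} (hy : y ∈ Icc (0 : ℝ) 1) :
    genExt ψ (pseudoInv ψ y) = y := by
  have hne : {z : ℝ≥0∞ | genExt ψ z = y}.Nonempty := by
    have := mem_range_of_exists_le_of_exists_ge h.continuous_genExt
      (c := y) ⟨∞, by rw [genExt_top]; exact hy.1⟩ ⟨0, by rw [h.genExt_zero]; exact hy.2⟩
    exact this
  have hcl : IsClosed {z : ℝ≥0∞ | genExt ψ z = y} :=
    isClosed_singleton.preimage h.continuous_genExt
  exact hcl.csInf_mem hne (OrderBot.bddBelow _)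

/-- An antitone Galois connection, valid for every level `z`: `φ(y)` is the least level at which `ψ`
has come down to `y`. -/
lemma genExt_le_iff (h : IsGenerator ψ) {y : ℝ} (hy : y ∈ Icc (0 : ℝ) 1) {z : ℝ≥0∞} :
    genExt ψ z ≤ y ↔ pseudoInv ψ y ≤ z := by
  constructor
  · intro hz
    rcases hz.eq_or_lt with hz | hz
    · exact sInf_le hz
    · by_contra! hlt
      have := h.antitone_genExt hlt.le
      rw [h.genExt_pseudoInv hy] at this
      linarith
  · intro hz
    exact (h.antitone_genExt hz).trans_eq (h.genExt_pseudoInv hy)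

lemma lt_genExt_iff (h : IsGenerator ψ) {y : ℝ} (hy : y ∈ Icc (0 : ℝ) 1) {z : ℝ≥0∞} :
    y < genExt ψ z ↔ z < pseudoInv ψ y := by
  rw [← not_le, h.genExt_le_iff hy, not_le]

lemma pseudoInv_anti (h : IsGenerator ψ) {x y : ℝ} (hx : x ∈ Icc (0 : ℝ) 1)
    (hy : y ∈ Icc (0 : ℝ) 1) (hxy : x ≤ y) : pseudoInv ψ y ≤ pseudoInv ψ x := by
  rw [← h.genExt_le_iff hy, h.genExt_pseudoInv hx]
  exact hxy

lemma pseudoInv_le (h : IsGenerator ψ) {x : ℝ} (hx : x ∈ Icc (0 : ℝ) 1) :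
    pseudoInv ψ x ≤ pseudoInv ψ 0 := h.pseudoInv_anti (by simp) hx hx.1

lemma pseudoInv_one (h : IsGenerator ψ) : pseudoInv ψ 1 = 0 := by
  rw [← nonpos_iff_eq_zero, ← h.genExt_le_iff (by simp), h.genExt_zero]

lemma genExt_eq_zero_iff (h : IsGenerator ψ) {z : ℝ≥0∞} :
    genExt ψ z = 0 ↔ pseudoInv ψ 0 ≤ z := by
  rw [← h.genExt_le_iff (by simp)]
  exact ⟨fun h => h.le, fun h' => le_antisymm h' (h.genExt_mem z).1⟩

lemma pseudoInv_genExt_of_le (h : IsGenerator ψ) {z : ℝ≥0∞} (hz : z ≤ pseudoInv ψ 0) :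
    pseudoInv ψ (genExt ψ z) = z :=
  h.strictAntiOn.injOn (h.pseudoInv_le (h.genExt_mem z)) hz (h.genExt_pseudoInv (h.genExt_mem z))

lemma pseudoInv_genExt (h : IsGenerator ψ) (z : ℝ≥0∞) :
    pseudoInv ψ (genExt ψ z) = min z (pseudoInv ψ 0) := by
  rcases le_total z (pseudoInv ψ 0) with hz | hz
  · rw [h.pseudoInv_genExt_of_le hz, min_eq_left hz]
  · rw [h.genExt_eq_zero_iff.2 hz, min_eq_right hz]

/-- The opposite connection rests on strict monotonicity, hence the bound on `z`: past `φ(0)` it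
fails for `y = 0`. -/
lemma le_genExt_iff (h : IsGenerator ψ) {y : ℝ} (hy : y ∈ Icc (0 : ℝ) 1) {z : ℝ≥0∞}
    (hz : z ≤ pseudoInv ψ 0) : y ≤ genExt ψ z ↔ z ≤ pseudoInv ψ y := by
  rw [← h.strictAntiOn.le_iff_ge (h.pseudoInv_le hy) hz, h.genExt_pseudoInv hy]

lemma pseudoInv_pos (h : IsGenerator ψ) {x : ℝ} (hx : x ∈ Icc (0 : ℝ) 1) (hx1 : x < 1) :
    0 < pseudoInv ψ x := by
  rwa [← h.lt_genExt_iff hx, h.genExt_zero]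

lemma pseudoInv_lt (h : IsGenerator ψ) {x : ℝ} (hx : x ∈ Icc (0 : ℝ) 1) (hx0 : 0 < x) :
    pseudoInv ψ x < pseudoInv ψ 0 := by
  rwa [← h.lt_genExt_iff (by simp), h.genExt_pseudoInv hx]

lemma pseudoInv_ne_top (h : IsGenerator ψ) {x : ℝ} (hx : x ∈ Icc (0 : ℝ) 1) (hx0 : 0 < x) :
    pseudoInv ψ x ≠ ∞ := (h.pseudoInv_lt hx hx0).ne_top

lemma pseudoInv_half (h : IsGenerator ψ) : pseudoInv ψ (1 / 2) = 1 := by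
  have h1 : genExt ψ 1 = 1 / 2 := by
    rw [← ENNReal.ofReal_one, genExt_ofReal ψ zero_le_one, h.normalized]
  rw [← h1]
  exact h.pseudoInv_genExt_of_le ((h.lt_genExt_iff (by simp)).1 (by rw [h1]; norm_num)).le

lemma continuous_pseudoInv (h : IsGenerator ψ) : Continuous fun x : I => pseudoInv ψ x := by
  rw [OrderTopology.continuous_iff]
  intro z
  constructor
  · have : (fun x : I => pseudoInv ψ x) ⁻¹' Ioi z = {x : I | (x : ℝ) < genExt ψ z} := by
      ext x; simp [h.lt_genExt_iff x.2]
    rw [this]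
    exact isOpen_lt continuous_subtype_val continuous_const
  · rcases le_or_gt z (pseudoInv ψ 0) with hz | hz
    · have : (fun x : I => pseudoInv ψ x) ⁻¹' Iio z = {x : I | genExt ψ z < (x : ℝ)} := by
        ext x
        rw [mem_preimage, mem_Iio, mem_ofPred_eq, ← not_le, ← h.le_genExt_iff x.2 hz, not_le]
      rw [this]
      exact isOpen_lt continuous_const continuous_subtype_val
    · have : (fun x : I => pseudoInv ψ x) ⁻¹' Iio z = univ :=
        eq_univ_of_forall fun x => (h.pseudoInv_le x.2).trans_lt hz
      rw [this]
      exact isOpen_univ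

/-- The extended generator as a map into the unit interval. -/
noncomputable def genUnit (h : IsGenerator ψ) (z : ℝ≥0∞) : I := ⟨genExt ψ z, h.genExt_mem z⟩

@[simp] lemma coe_genUnit (h : IsGenerator ψ) (z : ℝ≥0∞) : (h.genUnit z : ℝ) = genExt ψ z := rfl

lemma antitone_genUnit (h : IsGenerator ψ) : Antitone h.genUnit := fun _ _ hab =>
  h.antitone_genExt hab

lemma genUnit_zero (h : IsGenerator ψ) : h.genUnit 0 = 1 := Subtype.ext h.genExt_zero

/-- Since `φ ∘ ψ` truncates at `φ(0)`, levels are recovered only up to truncation; this is harmless,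
because one summand beyond `φ(0)` already puts both sums where `ψ` vanishes. -/
lemma genExt_sum_min (h : IsGenerator ψ) {ι : Type*} [Fintype ι] (z : ι → ℝ≥0∞) :
    genExt ψ (∑ i, min (z i) (pseudoInv ψ 0)) = genExt ψ (∑ i, z i) := by
  by_cases hz : ∀ i, z i ≤ pseudoInv ψ 0
  · simp_rw [min_eq_left (hz _)]
  · push Not at hz
    obtain ⟨i, hi⟩ := hz
    have h1 : pseudoInv ψ 0 ≤ ∑ i, min (z i) (pseudoInv ψ 0) :=
      (le_min hi.le le_rfl).trans
        (Finset.single_le_sum (f := fun i => min (z i) (pseudoInv ψ 0)) (fun _ _ => zero_le)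
          (Finset.mem_univ i))
    have h2 : pseudoInv ψ 0 ≤ ∑ i, z i :=
      hi.le.trans (Finset.single_le_sum (fun _ _ => zero_le) (Finset.mem_univ i))
    rw [h.genExt_eq_zero_iff.2 h1, h.genExt_eq_zero_iff.2 h2]

end IsGenerator

lemma IsArchimedeanCopula.apply_genUnit {d : ℕ} {C : (Fin d → I) → ℝ} {ψ : ℝ → ℝ}
    (hC : IsArchimedeanCopula C ψ) (z : Fin d → ℝ≥0∞) :
    C (fun i => hC.isGenerator.genUnit (z i)) = genExt ψ (∑ i, z i) := by
  rw [hC.eq_gen, ← hC.isGenerator.genExt_sum_min z]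
  simp only [IsGenerator.coe_genUnit, hC.isGenerator.pseudoInv_genExt]

/-! ### Convex functions of a real variable -/

/-- A continuous midpoint-convex function is convex. -/
lemma convexOn_of_midpoint_le {s : Set ℝ} (hs : Convex ℝ s) {f : ℝ → ℝ} (hf : ContinuousOn f s)
    (hmid : ∀ x ∈ s, ∀ y ∈ s, f ((x + y) / 2) ≤ (f x + f y) / 2) : ConvexOn ℝ s f := by
  refine ⟨hs, fun x hx y hy a b ha hb hab => ?_⟩
  have hseg : ∀ t ∈ Icc (0 : ℝ) 1, (1 - t) * x + t * y ∈ s := fun t ht => by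
    simpa using hs hx hy (sub_nonneg.2 ht.2) ht.1 (by ring)
  set g : ℝ → ℝ := fun t => f ((1 - t) * x + t * y) - ((1 - t) * f x + t * f y) with hg
  have hgc : ContinuousOn g (Icc 0 1) := by
    refine ContinuousOn.sub (hf.comp (by fun_prop) hseg) (by fun_prop)
  have hgm : ∀ t ∈ Icc (0 : ℝ) 1, ∀ u ∈ Icc (0 : ℝ) 1, g ((t + u) / 2) ≤ (g t + g u) / 2 := by
    intro t ht u hu
    have := hmid _ (hseg t ht) _ (hseg u hu)
    have e : (1 - (t + u) / 2) * x + (t + u) / 2 * y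
        = ((1 - t) * x + t * y + ((1 - u) * x + u * y)) / 2 := by ring
    simp only [hg, e]
    linarith
  have g0 : g 0 = 0 := by simp [hg]
  have g1 : g 1 = 0 := by simp [hg]
  obtain ⟨c, hc, hmax⟩ := isCompact_Icc.exists_isMaxOn (nonempty_Icc.2 zero_le_one) hgc
  -- The maximizer `c` is the midpoint of an endpoint, where `g = 0`, and another point of `[0, 1]`,
  -- so `g c ≤ g c / 2`.
  have hgc0 : g c ≤ 0 := by
    rcases le_total c (1 / 2) with h | h
    · have h2 : 2 * c ∈ Icc (0 : ℝ) 1 := ⟨by linarith [hc.1], by linarith⟩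
      have h3 := hgm 0 (by simp) _ h2
      rw [show (0 + 2 * c) / 2 = c by ring] at h3
      have h4 : g (2 * c) ≤ g c := hmax h2
      linarith
    · have h2 : 2 * c - 1 ∈ Icc (0 : ℝ) 1 := ⟨by linarith, by linarith [hc.2]⟩
      have h3 := hgm 1 (by simp) _ h2
      rw [show (1 + (2 * c - 1)) / 2 = c by ring] at h3
      have h4 : g (2 * c - 1) ≤ g c := hmax h2
      linarith
  have hb1 : b ∈ Icc (0 : ℝ) 1 := ⟨hb, by linarith⟩
  have h5 : g b ≤ g c := hmax hb1
  have h6 : a = 1 - b := by linarith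
  simp only [hg] at h5 hgc0
  simp only [smul_eq_mul, h6]
  linarith

/-- If the measure of `A a ∩ B b` depends only on `a + b` for two decreasing families of events,
then it is a convex function of `a + b`. -/
lemma convexOn_of_measureReal_inter {Ω : Type*} [MeasurableSpace Ω] {μ : Measure Ω}
    [IsFiniteMeasure μ] {A B : ℝ → Set Ω} (hA : Antitone A) (hB : Antitone B)
    (hAm : ∀ a, MeasurableSet (A a)) (hBm : ∀ b, MeasurableSet (B b)) {g : ℝ → ℝ}
    (hgc : ContinuousOn g (Ici 0))
    (hg : ∀ a b, 0 ≤ a → 0 ≤ b → μ.real (A a ∩ B b) = g (a + b)) : ConvexOn ℝ (Ici 0) g := by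
  have key : ∀ x h, 0 ≤ x → 0 ≤ h → 2 * g (x + h) ≤ g x + g (x + 2 * h) := by
    intro x h hx hh
    -- Inclusion–exclusion: the two events have mass `g (x + h)` each, their intersection has mass
    -- `g (x + 2h)`, and their union lies in an event of mass `g x`.
    have h1 := measureReal_union_add_inter (μ := μ) (s := A (x + h) ∩ B 0) (t := A x ∩ B h)
      ((hAm _).inter (hBm _))
    have h2 : A (x + h) ∩ B 0 ∩ (A x ∩ B h) = A (x + h) ∩ B h := by
      have i1 := hA (le_add_of_nonneg_right hh : x ≤ x + h)
      have i2 := hB hh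
      ext ω
      constructor
      · rintro ⟨⟨p, _⟩, _, q⟩; exact ⟨p, q⟩
      · rintro ⟨p, q⟩; exact ⟨⟨p, i2 q⟩, i1 p, q⟩
    have h3 : μ.real (A (x + h) ∩ B 0 ∪ A x ∩ B h) ≤ μ.real (A x ∩ B 0) :=
      measureReal_mono (union_subset
        (inter_subset_inter_left _ (hA (le_add_of_nonneg_right hh)))
        (inter_subset_inter_right _ (hB hh)))
    rw [h2, hg _ _ (by positivity) le_rfl, hg _ _ hx hh, hg _ _ (by positivity) hh] at h1
    rw [hg _ _ hx le_rfl] at h3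
    rw [show x + h + h = x + 2 * h by ring] at h1
    simp only [add_zero] at h1 h3
    linarith
  have key' : ∀ x y, 0 ≤ x → x ≤ y → g ((x + y) / 2) ≤ (g x + g y) / 2 := by
    intro x y hx hxy
    have := key x ((y - x) / 2) hx (by linarith)
    rw [show x + (y - x) / 2 = (x + y) / 2 by ring, show x + 2 * ((y - x) / 2) = y by ring] at this
    linarith
  refine convexOn_of_midpoint_le (convex_Ici 0) hgc fun x hx y hy => ?_
  rcases le_total x y with h | h
  · exact key' x y hx h
  · rw [add_comm x y, add_comm (g x)]
    exact key' y x hy h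

/-- If a sum of two convex functions is differentiable at an interior point, so is the first
summand. -/
lemma ConvexOn.differentiableAt_of_add {s : Set ℝ} {f g : ℝ → ℝ} (hf : ConvexOn ℝ s f)
    (hg : ConvexOn ℝ s g) {x : ℝ} (hx : x ∈ interior s)
    (hfg : DifferentiableAt ℝ (fun y => f y + g y) x) : DifferentiableAt ℝ f x := by
  have f1 := hf.hasDerivWithinAt_rightDeriv_of_mem_interior hx
  have f2 := hf.hasDerivWithinAt_leftDeriv_of_mem_interior hx
  have g1 := hg.hasDerivWithinAt_rightDeriv_of_mem_interior hx
  have g2 := hg.hasDerivWithinAt_leftDeriv_of_mem_interior hx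
  have f3 := hf.leftDeriv_le_rightDeriv_of_mem_interior hx
  have g3 := hg.leftDeriv_le_rightDeriv_of_mem_interior hx
  have e1 := (uniqueDiffWithinAt_Ioi x).eq_deriv _ (f1.add g1) hfg.hasDerivAt.hasDerivWithinAt
  have e2 := (uniqueDiffWithinAt_Iio x).eq_deriv _ (f2.add g2) hfg.hasDerivAt.hasDerivWithinAt
  -- Each left derivative is at most the right one, and the sums agree; so neither summand has a
  -- kink.
  have e3 : derivWithin f (Iio x) x = derivWithin f (Ioi x) x := by linarith
  rw [e3] at f2
  have := f2.union f1
  refine HasDerivAt.differentiableAt (f' := derivWithin f (Ioi x) x) ?_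
  rw [hasDerivAt_iff_tendsto_slope_left_right]
  exact ⟨(hasDerivWithinAt_iff_tendsto_slope' (by simp)).1 f2,
    (hasDerivWithinAt_iff_tendsto_slope' (by simp)).1 f1⟩

/-- A chord that avoids `x` leaves room for evaluation points moving near `x`. Its slope is twice
the slope over `[x, x + 2t]` minus the slope over `[x, x + t]`. -/
lemma HasDerivAt.tendsto_slope_add_two_mul {f : ℝ → ℝ} {x f' : ℝ} (hf : HasDerivAt f f' x) :
    Tendsto (fun t => slope f (x + t) (x + 2 * t)) (𝓝[≠] 0) (𝓝 f') := by
  have h1 := hasDerivAt_iff_tendsto_slope_zero.1 hf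
  have h2 : Tendsto (fun t : ℝ => 2 * t) (𝓝[≠] 0) (𝓝[≠] 0) := by
    refine tendsto_nhdsWithin_iff.2 ⟨?_, ?_⟩
    · have : Continuous fun t : ℝ => 2 * t := by fun_prop
      simpa using (this.tendsto 0).mono_left nhdsWithin_le_nhds
    · filter_upwards [self_mem_nhdsWithin] with t ht
      simpa using ht
  have h3 := ((h1.comp h2).const_mul 2).sub h1
  rw [show 2 * f' - f' = f' by ring] at h3
  refine h3.congr' ?_
  filter_upwards [self_mem_nhdsWithin] with t ht
  have ht : t ≠ 0 := ht
  simp only [Function.comp_apply, smul_eq_mul, slope_def_field]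
  rw [show x + 2 * t - (x + t) = t by ring]
  field_simp
  ring

/-- Derivatives of pointwise converging differentiable convex functions converge, locally uniformly
in the sense that the point of evaluation may vary. -/
lemma tendsto_deriv_of_convexOn {ι : Type*} {l : Filter ι} {S : Set ℝ} (hS : IsOpen S)
    {F : ι → ℝ → ℝ} {f : ℝ → ℝ} (hF : ∀ i, ConvexOn ℝ S (F i))
    (hFd : ∀ i, ∀ x ∈ S, DifferentiableAt ℝ (F i) x)
    (hlim : ∀ x ∈ S, Tendsto (fun i => F i x) l (𝓝 (f x))) {x : ℝ} (hx : x ∈ S)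
    (hf : DifferentiableAt ℝ f x) {u : ι → ℝ} (hu : Tendsto u l (𝓝 x)) :
    Tendsto (fun i => deriv (F i) (u i)) l (𝓝 (deriv f x)) := by
  have hsl := hf.hasDerivAt.tendsto_slope_add_two_mul
  have hSt : ∀ᶠ t in 𝓝 (0 : ℝ), x + t ∈ S ∧ x + 2 * t ∈ S := by
    have c1 : Continuous fun t : ℝ => x + t := by fun_prop
    have c2 : Continuous fun t : ℝ => x + 2 * t := by fun_prop
    exact (c1.continuousAt.eventually_mem (hS.mem_nhds (by simpa using hx))).and
      (c2.continuousAt.eventually_mem (hS.mem_nhds (by simpa using hx)))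
  have hslF : ∀ t, x + t ∈ S ∧ x + 2 * t ∈ S → Tendsto (fun i => slope (F i) (x + t) (x + 2 * t)) l
      (𝓝 (slope f (x + t) (x + 2 * t))) := by
    intro t ht
    simp only [slope_def_field]
    exact ((hlim _ ht.2).sub (hlim _ ht.1)).div_const _
  have huS : ∀ᶠ i in l, u i ∈ S := hu.eventually_mem (hS.mem_nhds hx)
  rw [tendsto_order]
  constructor
  · intro a ha
    have hev : ∀ᶠ t in 𝓝[<] (0 : ℝ), a < slope f (x + t) (x + 2 * t) :=
      (hsl.mono_left (nhdsWithin_mono _ fun t (ht : t < 0) => ht.ne)).eventually (lt_mem_nhds ha)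
    obtain ⟨t, ht1, htS, ht0⟩ :=
      (hev.and ((hSt.filter_mono nhdsWithin_le_nhds).and self_mem_nhdsWithin)).exists
    have ht0 : t < 0 := ht0
    filter_upwards [(hslF t htS).eventually (lt_mem_nhds ht1), huS,
      hu.eventually (lt_mem_nhds (show x + t < x by linarith))] with i h1 h2 h3
    -- The chord lies to the left of `u i`, so by convexity its slope is at most the derivative at
    -- its right end `x + t`, hence at most the derivative at `u i`.
    refine h1.trans_le ?_
    rw [slope_comm]
    exact ((hF i).slope_le_deriv htS.2 htS.1 (by linarith) (hFd i _ htS.1)).trans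
      ((hF i).monotoneOn_deriv (hFd i) htS.1 h2 h3.le)
  · intro a ha
    have hev : ∀ᶠ t in 𝓝[>] (0 : ℝ), slope f (x + t) (x + 2 * t) < a :=
      (hsl.mono_left (nhdsWithin_mono _ fun t (ht : 0 < t) => ht.ne')).eventually (gt_mem_nhds ha)
    obtain ⟨t, ht1, htS, ht0⟩ :=
      (hev.and ((hSt.filter_mono nhdsWithin_le_nhds).and self_mem_nhdsWithin)).exists
    have ht0 : 0 < t := ht0
    filter_upwards [(hslF t htS).eventually (gt_mem_nhds ht1), huS,
      hu.eventually (gt_mem_nhds (show x < x + t by linarith))] with i h1 h2 h3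
    refine lt_of_le_of_lt ?_ h1
    exact ((hF i).monotoneOn_deriv (hFd i) h2 htS.1 h3.le).trans
      ((hF i).deriv_le_slope htS.1 htS.2 (by linarith) (hFd i _ htS.1))

/-! ### Convexity and differentiability of the generator -/

/-- Convex generators which are differentiable on `(0, ∞)`. -/
structure IsConvexGenerator (ψ : ℝ → ℝ) : Prop extends IsGenerator ψ where
  convexOn : ConvexOn ℝ (Ici 0) ψ
  differentiableAt : ∀ s, 0 < s → DifferentiableAt ℝ ψ s

/-- The measure of a box with three nontrivial sides under an Archimedean copula. -/
lemma IsArchimedeanCopula.measureReal_setOf_le {k : ℕ} {C : (Fin (k + 3) → I) → ℝ} {ψ : ℝ → ℝ}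
    (hC : IsArchimedeanCopula C ψ) {μ : Measure (Fin (k + 3) → I)}
    (hμ : IsStochasticMeasureOf μ C) (a b c : ℝ≥0∞) :
    μ.real ({x | x 0 ≤ hC.isGenerator.genUnit a} ∩ {x | x 1 ≤ hC.isGenerator.genUnit b} ∩
      {x | x 2 ≤ hC.isGenerator.genUnit c}) = genExt ψ (a + b + c) := by
  set z : Fin (k + 3) → ℝ≥0∞ := Fin.cons a (Fin.cons b (Fin.cons c 0)) with hz
  have hsum : ∑ i, z i = a + b + c := by
    simp [hz, Fin.sum_univ_succ, add_assoc]
  rw [← hsum, ← hC.apply_genUnit, ← hμ.real_Iic]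
  congr 1
  ext x
  simp only [mem_inter_iff, mem_ofPred_eq, mem_Iic, Pi.le_def, Fin.forall_fin_succ, hz]
  simp only [Fin.cons_zero, Fin.cons_succ, Pi.zero_apply, hC.isGenerator.genUnit_zero]
  simp only [unitInterval.le_one', implies_true, and_true]
  exact and_assoc

/-- Both claims use the events `Xᵢ ≤ ψ(a)` for the first two coordinates, once under `μ` and once
under `μ` restricted to the set where the third coordinate exceeds `ψ(h)`. -/
lemma IsArchimedeanCopula.convexOn_aux {k : ℕ} {C : (Fin (k + 3) → I) → ℝ} {ψ : ℝ → ℝ}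
    (hC : IsArchimedeanCopula C ψ) {h : ℝ} (hh : 0 ≤ h) :
    ConvexOn ℝ (Ici 0) ψ ∧ ConvexOn ℝ (Ici 0) fun s => ψ s - ψ (s + h) := by
  obtain ⟨μ, hμ⟩ := hC.isCopula
  have := hμ.isProbabilityMeasure
  have hψ := hC.isGenerator
  let A : Fin (k + 3) → ℝ → Set (Fin (k + 3) → I) :=
    fun i a => {x | x i ≤ hψ.genUnit (ENNReal.ofReal a)}
  have hA : ∀ i, Antitone (A i) := fun i a b hab x hx =>
    le_trans hx (hψ.antitone_genUnit (ENNReal.ofReal_le_ofReal hab))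
  have hAm : ∀ i a, MeasurableSet (A i a) := fun i a =>
    measurableSet_le (measurable_pi_apply i) measurable_const
  have hμA : ∀ a b c, 0 ≤ a → 0 ≤ b → 0 ≤ c →
      μ.real (A 0 a ∩ A 1 b ∩ A 2 c) = ψ (a + b + c) := fun a b c ha hb hc => by
    rw [hC.measureReal_setOf_le hμ, ← ENNReal.ofReal_add ha hb,
      ← ENNReal.ofReal_add (by positivity) hc, IsGenerator.genExt_ofReal ψ (by positivity)]
  have hA0 : A 2 0 = univ := by
    refine eq_univ_of_forall fun x => ?_
    simp only [A, ENNReal.ofReal_zero, hψ.genUnit_zero]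
    exact unitInterval.le_one'
  have hμA' : ∀ a b, 0 ≤ a → 0 ≤ b → μ.real (A 0 a ∩ A 1 b) = ψ (a + b) := fun a b ha hb => by
    have := hμA a b 0 ha hb le_rfl
    rwa [hA0, inter_univ, add_zero] at this
  refine ⟨convexOn_of_measureReal_inter (hA 0) (hA 1) (hAm 0) (hAm 1) hψ.continuousOn hμA', ?_⟩
  refine convexOn_of_measureReal_inter (μ := μ.restrict (A 2 h)ᶜ) (hA 0) (hA 1) (hAm 0) (hAm 1)
    (hψ.continuousOn.sub (hψ.continuousOn.comp (by fun_prop) fun s hs => ?_)) fun a b ha hb => ?_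
  · exact add_nonneg hs hh
  · rw [measureReal_restrict_apply ((hAm 0 a).inter (hAm 1 b)), ← hμA a b h ha hb hh,
      ← hμA' a b ha hb, ← sdiff_eq,
      ← measureReal_inter_add_sdiff (μ := μ) (s := A 0 a ∩ A 1 b) (hAm 2 h)]
    ring

/-- The generator of an at least three-dimensional Archimedean copula is convex and
differentiable. -/
lemma IsArchimedeanCopula.isConvexGenerator {m : ℕ} (hm : 2 ≤ m) {C : (Fin (m + 1) → I) → ℝ}
    {ψ : ℝ → ℝ} (hC : IsArchimedeanCopula C ψ) : IsConvexGenerator ψ := by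
  obtain ⟨k, rfl⟩ := Nat.exists_eq_add_of_le' hm
  have hψ := hC.isGenerator
  have hcv := (hC.convexOn_aux le_rfl).1
  refine ⟨hψ, hcv, fun s hs => ?_⟩
  -- A monotone function is differentiable almost everywhere, so some `t < s` is a point of
  -- differentiability; it is transported to `s` by the shift `s - t`.
  have hae : ∀ᵐ t ∂(volume.restrict (Ioo 0 s)), DifferentiableWithinAt ℝ ψ (Ioo 0 s) t := by
    have := (MonotoneOn.ae_differentiableWithinAt (f := fun x => -ψ x) (s := Ioo 0 s)
      (fun a ha b hb hab => neg_le_neg (hψ.antitoneOn ha.1.le hb.1.le hab)) measurableSet_Ioo)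
    filter_upwards [this] with t ht
    simpa using ht.neg
  have : NeBot (ae (volume.restrict (Ioo 0 s))) := by
    rw [ae_neBot, Ne, Measure.restrict_eq_zero]
    simp [hs]
  obtain ⟨t, ht, htm⟩ := (hae.and (ae_restrict_mem measurableSet_Ioo)).exists
  have htd : DifferentiableAt ℝ ψ t := ht.differentiableAt (Ioo_mem_nhds htm.1 htm.2)
  have hh : 0 ≤ s - t := by linarith [htm.2]
  have hcv' : ConvexOn ℝ (Ici 0) fun x => ψ (x + (s - t)) := by
    have := hcv.translate_left (s - t)
    refine this.subset (fun x hx => ?_) (convex_Ici 0)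
    exact add_nonneg hh hx
  have hd := hcv'.differentiableAt_of_add (hC.convexOn_aux hh).2 (x := t)
    (by rw [interior_Ici]; exact htm.1) (by simpa using htd)
  have h2 : DifferentiableAt ℝ (fun y => ψ (y - (s - t) + (s - t))) s :=
    DifferentiableAt.comp (g := fun x => ψ (x + (s - t))) (f := fun y => y - (s - t)) s
      (by simpa using hd) (by fun_prop)
  simpa using h2

/-! ### The derivative of the generator -/

namespace IsConvexGenerator

variable {ψ : ℝ → ℝ}

lemma genDeriv_top (ψ : ℝ → ℝ) : genDeriv ψ ∞ = 0 := if_pos rfl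

lemma genDeriv_of_ne_top (ψ : ℝ → ℝ) {z : ℝ≥0∞} (hz : z ≠ ∞) : genDeriv ψ z = deriv ψ z.toReal :=
  if_neg hz

lemma monotoneOn_deriv (h : IsConvexGenerator ψ) : MonotoneOn (deriv ψ) (Ioi 0) :=
  (h.convexOn.subset Ioi_subset_Ici_self (convex_Ioi 0)).monotoneOn_deriv h.differentiableAt

lemma deriv_nonpos (h : IsConvexGenerator ψ) {s : ℝ} (hs : 0 < s) : deriv ψ s ≤ 0 := by
  refine (h.convexOn.deriv_le_slope (y := s + 1) hs.le (by simp; positivity) (by linarith)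
    (h.differentiableAt s hs)).trans ?_
  rw [slope_def_field]
  have := h.antitoneOn (a := s) hs.le (b := s + 1) (by simp; positivity) (by linarith)
  simpa using this

lemma genDeriv_nonpos (h : IsConvexGenerator ψ) {z : ℝ≥0∞} (hz : 0 < z) : genDeriv ψ z ≤ 0 := by
  rcases eq_or_ne z ∞ with rfl | hz'
  · rw [genDeriv_top]
  · rw [genDeriv_of_ne_top ψ hz']
    exact h.deriv_nonpos (ENNReal.toReal_pos hz.ne' hz')

lemma genDeriv_mono (h : IsConvexGenerator ψ) {a b : ℝ≥0∞} (ha : 0 < a) (hab : a ≤ b) :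
    genDeriv ψ a ≤ genDeriv ψ b := by
  rcases eq_or_ne b ∞ with rfl | hb
  · rw [genDeriv_top]; exact h.genDeriv_nonpos ha
  · have ha' := ne_top_of_le_ne_top hb hab
    rw [genDeriv_of_ne_top ψ hb, genDeriv_of_ne_top ψ ha']
    exact h.monotoneOn_deriv (ENNReal.toReal_pos ha.ne' ha')
      (ENNReal.toReal_pos (ha.trans_le hab).ne' hb) (ENNReal.toReal_mono hb hab)

lemma pseudoInv_zero_pos (h : IsConvexGenerator ψ) : 0 < pseudoInv ψ 0 :=
  h.pseudoInv_pos (by simp) zero_lt_one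

/-- Every finite zero of `ψ` is a minimum; differentiability rules out a kink at `φ(0)` itself. -/
lemma genDeriv_eq_zero (h : IsConvexGenerator ψ) {z : ℝ≥0∞} (hz : pseudoInv ψ 0 ≤ z) :
    genDeriv ψ z = 0 := by
  rcases eq_or_ne z ∞ with rfl | hz'
  · rw [genDeriv_top]
  · rw [genDeriv_of_ne_top ψ hz']
    have hpos := ENNReal.toReal_pos (h.pseudoInv_zero_pos.trans_le hz).ne' hz'
    have h0 : ψ z.toReal = 0 := by
      rw [← IsGenerator.genExt_of_ne_top ψ hz']
      exact h.genExt_eq_zero_iff.2 hz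
    refine IsLocalMin.deriv_eq_zero ?_
    filter_upwards [Ioi_mem_nhds hpos] with t ht
    rw [h0]
    exact (h.mapsTo (mem_Ioi.1 ht).le).1

/-- By convexity a horizontal tangent at a positive value would keep `ψ` above that value,
contradicting its limit `0`. -/
lemma genDeriv_neg (h : IsConvexGenerator ψ) {z : ℝ≥0∞} (hz0 : 0 < z) (hz : z < pseudoInv ψ 0) :
    genDeriv ψ z < 0 := by
  refine (h.genDeriv_nonpos hz0).lt_of_ne fun h0 => ?_
  rw [genDeriv_of_ne_top ψ hz.ne_top] at h0
  have hs := ENNReal.toReal_pos hz0.ne' hz.ne_top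
  set s := z.toReal
  have hψs : 0 < ψ s := by
    rw [← IsGenerator.genExt_of_ne_top ψ hz.ne_top]
    exact (h.lt_genExt_iff (by simp)).2 hz
  have hge : ∀ t, s < t → ψ s ≤ ψ t := by
    intro t ht
    have h1 := h.convexOn.deriv_le_slope hs.le (hs.trans ht).le ht (h.differentiableAt s hs)
    rw [h0, slope_def_field] at h1
    have h2 := mul_nonneg h1 (sub_pos.2 ht).le
    rw [div_mul_cancel₀ _ (sub_pos.2 ht).ne'] at h2
    linarith
  have := ge_of_tendsto h.tendsto_zero ((eventually_gt_atTop s).mono hge)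
  linarith

lemma tendsto_deriv (h : IsConvexGenerator ψ) {s : ℝ} (hs : 0 < s) :
    Tendsto (deriv ψ) (𝓝 s) (𝓝 (deriv ψ s)) :=
  tendsto_deriv_of_convexOn (F := fun _ => ψ) isOpen_Ioi
    (fun _ => h.convexOn.subset Ioi_subset_Ici_self (convex_Ioi 0)) (fun _ => h.differentiableAt)
    (fun _ _ => tendsto_const_nhds) hs (h.differentiableAt s hs) tendsto_id

lemma continuousAt_genDeriv (h : IsConvexGenerator ψ) {z : ℝ≥0∞} (hz : 0 < z) :
    ContinuousAt (genDeriv ψ) z := by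
  rcases eq_or_ne z ∞ with rfl | hz'
  · rw [ContinuousAt, genDeriv_top, tendsto_order]
    refine ⟨fun a ha => ?_, fun a ha => ?_⟩
    -- Convexity gives `-ψ(N) ≤ ψ(N + 1) - ψ(N) ≤ ψ'(N + 1)`, so smallness of `ψ` controls the
    -- derivative.
    · obtain ⟨N, hN, hN1⟩ := (((tendsto_order.1 h.tendsto_zero).2 (-a) (by linarith)).and
        (eventually_gt_atTop 0)).exists
      refine ENNReal.nhds_top_basis.eventually_iff.2
        ⟨ENNReal.ofReal (N + 1), ENNReal.ofReal_lt_top, fun z hz => ?_⟩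
      have hN2 : 0 < N + 1 := by linarith
      refine lt_of_lt_of_le ?_ (h.genDeriv_mono (ENNReal.ofReal_pos.2 hN2) (le_of_lt hz))
      rw [genDeriv_of_ne_top ψ ENNReal.ofReal_ne_top, ENNReal.toReal_ofReal hN2.le]
      have h1 := h.convexOn.slope_le_deriv hN1.le hN2.le (by linarith)
        (h.differentiableAt _ hN2)
      rw [slope_def_field] at h1
      have h2 := (h.mapsTo hN2.le).1
      simp only [add_sub_cancel_left, div_one] at h1
      linarith
    · filter_upwards [Ioi_mem_nhds ENNReal.zero_lt_top] with z hz
      exact (h.genDeriv_nonpos hz).trans_lt ha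
  · have h1 : Tendsto (fun z : ℝ≥0∞ => deriv ψ z.toReal) (𝓝 z) (𝓝 (deriv ψ z.toReal)) :=
      (h.tendsto_deriv (ENNReal.toReal_pos hz.ne' hz')).comp (ENNReal.tendsto_toReal hz')
    rw [← genDeriv_of_ne_top ψ hz'] at h1
    refine h1.congr' ?_
    filter_upwards [isOpen_ne.mem_nhds hz'] with w hw
    rw [genDeriv_of_ne_top ψ hw]

end IsConvexGenerator

/-! ### The kernel formula and its integral -/

lemma IsArchimedeanCopula.apply_cons {m : ℕ} {C : (Fin (m + 1) → I) → ℝ} {ψ : ℝ → ℝ}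
    (hC : IsArchimedeanCopula C ψ) (x : I) (y : Fin m → I) :
    C (Fin.cons x y) = genExt ψ (pseudoInv ψ x + ∑ j, pseudoInv ψ (y j)) := by
  rw [hC.eq_gen, Fin.sum_univ_succ]
  simp

/-- The middle case of the definition is redundant: on all of `L₀` the numerator already vanishes.
-/
lemma IsArchimedeanCopula.archKernelCDF_eq {m : ℕ} {C : (Fin (m + 1) → I) → ℝ} {ψ : ℝ → ℝ}
    (hC : IsArchimedeanCopula C ψ) (hψ : IsConvexGenerator ψ) {x : I} (hx : x ∈ Ioo (0 : I) 1)
    (y : Fin m → I) :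
    archKernelCDF C ψ x y =
      genDeriv ψ (pseudoInv ψ x + ∑ j, pseudoInv ψ (y j)) / genDeriv ψ (pseudoInv ψ x) := by
  rw [archKernelCDF, if_neg (not_or.2 ⟨hx.1.ne', hx.2.ne⟩)]
  split_ifs with hint
  · have h0 : Fin.cons x y ∈ zeroSet C := interior_subset hint
    rw [zeroSet, mem_ofPred_eq, hC.apply_cons, hψ.genExt_eq_zero_iff] at h0
    rw [hψ.genDeriv_eq_zero h0, zero_div]
  · rfl

namespace IsConvexGenerator

variable {ψ : ℝ → ℝ}

lemma hasDerivAt_pseudoInv (h : IsConvexGenerator ψ) {t : ℝ} (ht : t ∈ Ioo (0 : ℝ) 1) :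
    HasDerivAt (fun x => (pseudoInv ψ x).toReal) (genDeriv ψ (pseudoInv ψ t))⁻¹ t := by
  have htI : t ∈ Icc (0 : ℝ) 1 := Ioo_subset_Icc_self ht
  have htop := h.pseudoInv_ne_top htI ht.1
  have hpos := h.pseudoInv_pos htI ht.2
  have hcont : ContinuousAt (fun x => (pseudoInv ψ x).toReal) t := by
    have h1 : ContinuousOn (fun x => pseudoInv ψ x) (Icc 0 1) :=
      continuousOn_iff_continuous_domRestrict.2 h.continuous_pseudoInv
    exact (ENNReal.tendsto_toReal htop).comp (h1.continuousAt (Icc_mem_nhds ht.1 ht.2))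
  rw [genDeriv_of_ne_top ψ htop]
  refine HasDerivAt.of_local_left_inverse (f := ψ) hcont
    (h.differentiableAt _ (ENNReal.toReal_pos hpos.ne' htop)).hasDerivAt ?_ ?_
  · rw [← genDeriv_of_ne_top ψ htop]
    exact (h.genDeriv_neg hpos (h.pseudoInv_lt htI ht.1)).ne
  · filter_upwards [Ioo_mem_nhds ht.1 ht.2] with y hy
    have hyI : y ∈ Icc (0 : ℝ) 1 := Ioo_subset_Icc_self hy
    rw [← IsGenerator.genExt_of_ne_top ψ (h.pseudoInv_ne_top hyI hy.1), h.genExt_pseudoInv hyI]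

lemma hasDerivAt_genExt_pseudoInv_add (h : IsConvexGenerator ψ) {c : ℝ≥0∞} (hc : c ≠ ∞) {t : ℝ}
    (ht : t ∈ Ioo (0 : ℝ) 1) :
    HasDerivAt (fun x => genExt ψ (pseudoInv ψ x + c))
      (genDeriv ψ (pseudoInv ψ t + c) / genDeriv ψ (pseudoInv ψ t)) t := by
  have htI : t ∈ Icc (0 : ℝ) 1 := Ioo_subset_Icc_self ht
  have htop := h.pseudoInv_ne_top htI ht.1
  have hpos := h.pseudoInv_pos htI ht.2
  have h1 := (h.hasDerivAt_pseudoInv ht).add_const c.toReal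
  have hpos' : 0 < (pseudoInv ψ t).toReal + c.toReal :=
    add_pos_of_pos_of_nonneg (ENNReal.toReal_pos hpos.ne' htop) ENNReal.toReal_nonneg
  have h2 := HasDerivAt.comp t (h.differentiableAt _ hpos').hasDerivAt h1
  rw [genDeriv_of_ne_top ψ (ENNReal.add_ne_top.2 ⟨htop, hc⟩), ENNReal.toReal_add htop hc,
    div_eq_mul_inv]
  refine h2.congr_of_eventuallyEq ?_
  filter_upwards [Ioo_mem_nhds ht.1 ht.2] with y hy
  have hyI : y ∈ Icc (0 : ℝ) 1 := Ioo_subset_Icc_self hy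
  have hytop := h.pseudoInv_ne_top hyI hy.1
  rw [IsGenerator.genExt_of_ne_top ψ (ENNReal.add_ne_top.2 ⟨hytop, hc⟩),
    ENNReal.toReal_add hytop hc]
  rfl

lemma genDeriv_div_nonneg (h : IsConvexGenerator ψ) {s t : ℝ≥0∞} (hs : 0 < s) (ht : 0 < t) :
    0 ≤ genDeriv ψ s / genDeriv ψ t :=
  div_nonneg_of_nonpos (h.genDeriv_nonpos hs) (h.genDeriv_nonpos ht)

/-- Fundamental theorem of calculus for `t ↦ ψ(φ(t) + c)`, which is continuous on `[0, 1]` and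
vanishes at `0`. Integrability of the derivative comes from its sign. -/
lemma setLIntegral_genDeriv_div (h : IsConvexGenerator ψ) (c : ℝ≥0∞) (x : I) :
    ∫⁻ t : I in Iic x, ENNReal.ofReal
        (genDeriv ψ (pseudoInv ψ t + c) / genDeriv ψ (pseudoInv ψ t)) =
      ENNReal.ofReal (genExt ψ (pseudoInv ψ x + c)) := by
  rcases eq_or_ne c ∞ with rfl | hc
  · simp [genDeriv_top, IsGenerator.genExt_top]
  set G : ℝ → ℝ := fun t => genDeriv ψ (pseudoInv ψ t + c) / genDeriv ψ (pseudoInv ψ t)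
  set H : ℝ → ℝ := fun t => genExt ψ (pseudoInv ψ t + c)
  have hH : ContinuousOn H (Icc 0 1) := by
    refine continuousOn_iff_continuous_domRestrict.2 ?_
    exact h.continuous_genExt.comp (h.continuous_pseudoInv.add continuous_const)
  have hsub : Icc (0 : ℝ) x ⊆ Icc 0 1 := Icc_subset_Icc_right x.2.2
  have hsub' : Ioo (0 : ℝ) x ⊆ Ioo 0 1 := Ioo_subset_Ioo_right x.2.2
  have hd : ∀ t ∈ Ioo (0 : ℝ) x, HasDerivAt H (G t) t := fun t ht =>
    h.hasDerivAt_genExt_pseudoInv_add hc (hsub' ht)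
  have hG0 : ∀ t ∈ Ioo (0 : ℝ) x, 0 ≤ G t := fun t ht => by
    have hp := h.pseudoInv_pos (Ioo_subset_Icc_self (hsub' ht)) (hsub' ht).2
    exact h.genDeriv_div_nonneg (hp.trans_le le_self_add) hp
  have hint := intervalIntegral.integrableOn_deriv_of_nonneg (hH.mono hsub) hd hG0
  have hftc : ∫ t in (0 : ℝ)..x, G t = H x - H 0 :=
    intervalIntegral.integral_eq_sub_of_hasDeriv_right_of_le x.2.1 (hH.mono hsub)
      (fun t ht => (hd t ht).hasDerivWithinAt)
      ((intervalIntegrable_iff_integrableOn_Ioc_of_le x.2.1).2 hint)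
  have hH0 : H 0 = 0 := h.genExt_eq_zero_iff.2 le_self_add
  have e1 := unitInterval.measurePreserving_coe.setLIntegral_comp_preimage_emb
    unitInterval.measurableEmbedding_coe (fun t => ENNReal.ofReal (G t)) (Iic (x : ℝ))
  have e2 : Iic (x : ℝ) ∩ I = Icc 0 (x : ℝ) := by
    ext t
    exact ⟨fun ht => ⟨ht.2.1, ht.1⟩, fun ht => ⟨ht.2, hsub ht⟩⟩
  rw [Measure.restrict_restrict measurableSet_Iic, e2] at e1
  refine e1.trans ?_
  rw [Measure.restrict_congr_set Ioo_ae_eq_Icc.symm,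
    ← ofReal_integral_eq_lintegral_ofReal (hint.mono_set Ioo_subset_Ioc_self)
      ((ae_restrict_mem measurableSet_Ioo).mono hG0),
    ← integral_Ioc_eq_integral_Ioo, ← intervalIntegral.integral_of_le x.2.1, hftc, hH0, sub_zero]

lemma measurable_genDeriv_div (h : IsConvexGenerator ψ) (c : ℝ≥0∞) :
    Measurable fun t : I => genDeriv ψ (pseudoInv ψ t + c) / genDeriv ψ (pseudoInv ψ t) := by
  have hm : Measurable (genDeriv ψ) := by
    unfold genDeriv
    exact Measurable.ite (measurableSet_singleton _) measurable_const
      ((measurable_deriv ψ).comp ENNReal.measurable_toReal)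
  have hφ := h.continuous_pseudoInv.measurable
  exact (hm.comp (hφ.add_const c)).div (hm.comp hφ)

end IsConvexGenerator

lemma unitInterval.ae_mem_Ioo : ∀ᵐ t : I, t ∈ Ioo (0 : I) 1 := by
  filter_upwards [(measure_eq_zero_iff_ae_notMem.1 (measure_singleton (μ := volume) (0 : I))),
    (measure_eq_zero_iff_ae_notMem.1 (measure_singleton (μ := volume) (1 : I)))] with t h0 h1
  exact ⟨lt_of_le_of_ne unitInterval.nonneg' (Ne.symm h0), lt_of_le_of_ne unitInterval.le_one' h1⟩

lemma IsArchimedeanCopula.setLIntegral_archKernelCDF {m : ℕ} {C : (Fin (m + 1) → I) → ℝ}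
    {ψ : ℝ → ℝ} (hC : IsArchimedeanCopula C ψ) (hψ : IsConvexGenerator ψ) (x : I)
    (y : Fin m → I) :
    ∫⁻ t in Iic x, ENNReal.ofReal (archKernelCDF C ψ t y) = ENNReal.ofReal (C (Fin.cons x y)) := by
  rw [hC.apply_cons, ← hψ.setLIntegral_genDeriv_div]
  refine lintegral_congr_ae (ae_restrict_of_ae ?_)
  filter_upwards [unitInterval.ae_mem_Ioo] with t ht
  rw [hC.archKernelCDF_eq hψ ht]

lemma IsArchimedeanCopula.measurable_archKernelCDF {m : ℕ} {C : (Fin (m + 1) → I) → ℝ}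
    {ψ : ℝ → ℝ} (hC : IsArchimedeanCopula C ψ) (hψ : IsConvexGenerator ψ) (y : Fin m → I) :
    Measurable fun t => archKernelCDF C ψ t y := by
  have h1 : (fun t => archKernelCDF C ψ t y) = (Ioo (0 : I) 1).piecewise
      (fun t : I => genDeriv ψ (pseudoInv ψ t + ∑ j, pseudoInv ψ (y j)) /
        genDeriv ψ (pseudoInv ψ t)) fun _ => 1 := by
    ext t
    by_cases ht : t ∈ Ioo (0 : I) 1
    · rw [piecewise_eq_of_mem _ _ _ ht, hC.archKernelCDF_eq hψ ht]
    · rw [piecewise_eq_of_notMem _ _ _ ht, archKernelCDF, if_pos]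
      by_contra! hne
      exact ht ⟨lt_of_le_of_ne unitInterval.nonneg' hne.1.symm,
        lt_of_le_of_ne unitInterval.le_one' hne.2⟩
  rw [h1]
  exact (hψ.measurable_genDeriv_div _).piecewise measurableSet_Ioo measurable_const

lemma IsArchimedeanCopula.archKernelCDF_nonneg {m : ℕ} {C : (Fin (m + 1) → I) → ℝ}
    {ψ : ℝ → ℝ} (hC : IsArchimedeanCopula C ψ) (hψ : IsConvexGenerator ψ) (t : I)
    (y : Fin m → I) : 0 ≤ archKernelCDF C ψ t y := by
  by_cases ht : t ∈ Ioo (0 : I) 1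
  · rw [hC.archKernelCDF_eq hψ ht]
    have hp := hψ.pseudoInv_pos t.2 ht.2
    exact hψ.genDeriv_div_nonneg (hp.trans_le le_self_add) hp
  · rw [archKernelCDF, if_pos]
    · exact zero_le_one
    · by_contra! hne
      exact ht ⟨lt_of_le_of_ne unitInterval.nonneg' hne.1.symm,
        lt_of_le_of_ne unitInterval.le_one' hne.2⟩

/-! ### Distribution functions and agreement almost everywhere -/

lemma MeasurableSpace.pi_eq_generateFrom_range_Iic (m : ℕ) :
    (MeasurableSpace.pi : MeasurableSpace (Fin m → I)) =
      MeasurableSpace.generateFrom (range Iic) := by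
  have h1 := generateFrom_eq_pi (ι := Fin m) (α := fun _ => I) (C := fun _ => range Iic)
    (fun _ => by rw [← borel_eq_generateFrom_Iic, BorelSpace.measurable_eq (α := I)])
    (fun _ => ⟨fun _ => univ, fun _ => ⟨1, Iic_top⟩, iUnion_const univ⟩)
  rw [← h1]
  congr 1
  ext s
  constructor
  · rintro ⟨f, hf, rfl⟩
    choose y hy using fun i => hf i (mem_univ i)
    refine ⟨y, ?_⟩
    rw [← pi_univ_Iic]
    simp only [hy]
  · rintro ⟨y, rfl⟩
    exact ⟨fun i => Iic (y i), fun i _ => ⟨y i, rfl⟩, pi_univ_Iic y⟩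

lemma isPiSystem_range_Iic {α : Type*} [SemilatticeInf α] :
    IsPiSystem (range (Iic : α → Set α)) := by
  rintro _ ⟨a, rfl⟩ _ ⟨b, rfl⟩ _
  exact ⟨a ⊓ b, Iic_inter_Iic.symm⟩

lemma isCountablySpanning_range_Iic {α : Type*} [Preorder α] [OrderTop α] :
    IsCountablySpanning (range (Iic : α → Set α)) :=
  ⟨fun _ => univ, fun _ => ⟨⊤, Iic_top⟩, iUnion_const univ⟩

/-- Finite measures on `𝕀 × 𝕀^m` are determined by their distribution functions. -/
lemma MeasureTheory.Measure.ext_of_Iic_prod {m : ℕ} {μ ν : Measure (I × (Fin m → I))}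
    [IsFiniteMeasure μ] (h : ∀ x y, μ (Iic x ×ˢ Iic y) = ν (Iic x ×ˢ Iic y)) : μ = ν := by
  have hgen := generateFrom_eq_prod (C := range (Iic : I → Set I))
    (D := range (Iic : (Fin m → I) → Set (Fin m → I)))
    (by rw [← borel_eq_generateFrom_Iic, BorelSpace.measurable_eq (α := I)])
    (MeasurableSpace.pi_eq_generateFrom_range_Iic m).symm
    isCountablySpanning_range_Iic isCountablySpanning_range_Iic
  refine ext_of_generate_finite _ hgen.symm (isPiSystem_range_Iic.prod isPiSystem_range_Iic) ?_ ?_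
  · rintro _ ⟨_, ⟨x, rfl⟩, _, ⟨y, rfl⟩, rfl⟩
    exact h x y
  · have := h ⊤ ⊤
    simpa only [Iic_top, univ_prod_univ] using this

/-- A monotone function on `𝕀^m` which agrees with a continuous one at rational points agrees with
it everywhere. -/
lemma eq_of_monotone_of_continuous_of_rat {m : ℕ} {F G : (Fin m → I) → ℝ} (hF : Monotone F)
    (hG : Continuous G)
    (h : ∀ q : Fin m → ℚ, F (fun j => projIcc 0 1 zero_le_one (q j : ℝ)) =
      G fun j => projIcc 0 1 zero_le_one (q j : ℝ)) : F = G := by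
  funext y
  have hlim : ∀ v : Fin m → ℕ → ℚ, (∀ j, Tendsto (fun n => (v j n : ℝ)) atTop (𝓝 (y j))) →
      Tendsto (fun n => F fun j => projIcc 0 1 zero_le_one (v j n : ℝ)) atTop (𝓝 (G y)) := by
    intro v hv
    simp_rw [fun n => h fun j => v j n]
    refine (hG.tendsto y).comp (tendsto_pi_nhds.2 fun j => ?_)
    have := ((continuous_projIcc (h := zero_le_one (α := ℝ))).tendsto (y j : ℝ)).comp (hv j)
    rwa [projIcc_val] at this
  apply le_antisymm
  -- Rational points approach `y` from above here and from below in the other half; `projIcc`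
  -- absorbs a ceiling that overshoots `1`.
  · refine ge_of_tendsto (hlim (fun j n => (⌈(y j : ℝ) * n⌉₊ : ℚ) / n) fun j => ?_) ?_
    · have := (tendsto_nat_ceil_mul_div_atTop (y j).2.1).comp tendsto_natCast_atTop_atTop
      simpa [Function.comp_def] using this
    · filter_upwards [eventually_gt_atTop 0] with n hn
      refine hF fun j => ?_
      conv_lhs => rw [← projIcc_val zero_le_one (y j)]
      refine monotone_projIcc _ ?_
      have hn' : (0 : ℝ) < n := Nat.cast_pos.2 hn
      push_cast
      rw [le_div_iff₀ hn']
      exact Nat.le_ceil _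
  · refine le_of_tendsto (hlim (fun j n => (⌊(y j : ℝ) * n⌋₊ : ℚ) / n) fun j => ?_) ?_
    · have := (tendsto_nat_floor_mul_div_atTop (y j).2.1).comp tendsto_natCast_atTop_atTop
      simpa [Function.comp_def] using this
    · filter_upwards [eventually_gt_atTop 0] with n hn
      refine hF fun j => ?_
      conv_rhs => rw [← projIcc_val zero_le_one (y j)]
      refine monotone_projIcc _ ?_
      have hn' : (0 : ℝ) < n := Nat.cast_pos.2 hn
      push_cast
      rw [div_le_iff₀ hn']
      exact Nat.floor_le (mul_nonneg (y j).2.1 hn'.le)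

lemma IsConvexGenerator.continuous_genDeriv_add_sum {ψ : ℝ → ℝ} (h : IsConvexGenerator ψ) {m : ℕ}
    {t : ℝ≥0∞} (ht : 0 < t) :
    Continuous fun y : Fin m → I => genDeriv ψ (t + ∑ j, pseudoInv ψ (y j)) := by
  rw [continuous_iff_continuousAt]
  intro y
  refine ContinuousAt.comp (g := genDeriv ψ) (h.continuousAt_genDeriv (ht.trans_le le_self_add)) ?_
  refine Continuous.continuousAt (continuous_const.add (continuous_finsetSum _ fun j _ => ?_))
  exact h.continuous_pseudoInv.comp (continuous_apply j)

lemma measurable_fin_tail {m : ℕ} : Measurable fun x : Fin (m + 1) → I => (Fin.tail x : Fin m → I) :=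
  measurable_pi_iff.2 fun i => measurable_pi_apply i.succ

lemma IsStochasticMeasureOf.map_prod_apply {m : ℕ} {μ : Measure (Fin (m + 1) → I)}
    {C : (Fin (m + 1) → I) → ℝ} (hμ : IsStochasticMeasureOf μ C) (x : I) (y : Fin m → I) :
    μ.map (fun x => (x 0, Fin.tail x)) (Iic x ×ˢ Iic y) = ENNReal.ofReal (C (Fin.cons x y)) := by
  have := hμ.isProbabilityMeasure
  rw [Measure.map_apply ((measurable_pi_apply 0).prodMk measurable_fin_tail)
    (measurableSet_Iic.prod measurableSet_Iic), ← hμ.real_Iic, ofReal_measureReal]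
  congr 1
  ext z
  simp [Pi.le_def, Fin.forall_fin_succ, Fin.tail]

/-- The regular conditional distribution of an Archimedean copula agrees almost everywhere with its
distinguished version. -/
lemma IsArchimedeanCopula.exists_kernel_ae {m : ℕ} {C : (Fin (m + 1) → I) → ℝ} {ψ : ℝ → ℝ}
    (hC : IsArchimedeanCopula C ψ) (hψ : IsConvexGenerator ψ) :
    ∃ K : Kernel I (Fin m → I), IsMarkovKernel K ∧
      ∀ᵐ t, ∀ y, (K t).real (Iic y) = archKernelCDF C ψ t y := by
  obtain ⟨μ, hμ⟩ := hC.isCopula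
  have := hμ.isProbabilityMeasure
  let K : Kernel I (Fin m → I) := condDistrib (fun x => Fin.tail x) (fun x => x 0) μ
  have hK : volume ⊗ₘ K = μ.map fun x => (x 0, Fin.tail x) := by
    rw [← hμ.map_eval 0]
    exact compProd_map_condDistrib measurable_fin_tail.aemeasurable
  have hy : ∀ y, ∀ᵐ t, (K t).real (Iic y) = archKernelCDF C ψ t y := by
    intro y
    have hm1 : Measurable fun t => K t (Iic y) := K.measurable_coe measurableSet_Iic
    have hm2 : Measurable fun t => ENNReal.ofReal (archKernelCDF C ψ t y) :=
      (hC.measurable_archKernelCDF hψ y).ennreal_ofReal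
    have hfin : ∫⁻ t, K t (Iic y) ∂(volume : Measure I) ≠ ∞ := by
      refine ne_top_of_le_ne_top (b := 1) ENNReal.one_ne_top ?_
      calc ∫⁻ t, K t (Iic y) ∂(volume : Measure I) ≤ ∫⁻ _, 1 ∂(volume : Measure I) :=
            lintegral_mono fun t => prob_le_one
        _ = 1 := by simp
    have : IsFiniteMeasure ((volume : Measure I).withDensity fun t => K t (Iic y)) :=
      isFiniteMeasure_withDensity hfin
    -- For fixed `y` both sides are densities of one measure, with distribution function `x ↦ C(x,
    -- y)`.
    have heq : (volume : Measure I).withDensity (fun t => K t (Iic y)) =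
        volume.withDensity fun t => ENNReal.ofReal (archKernelCDF C ψ t y) := by
      refine Measure.ext_of_Iic _ _ fun x => ?_
      rw [withDensity_apply _ measurableSet_Iic, withDensity_apply _ measurableSet_Iic,
        hC.setLIntegral_archKernelCDF hψ,
        ← Measure.compProd_apply_prod measurableSet_Iic measurableSet_Iic, hK, hμ.map_prod_apply]
    rw [withDensity_eq_iff hm1.aemeasurable hm2.aemeasurable hfin] at heq
    filter_upwards [heq] with t ht
    rw [measureReal_def, ht, ENNReal.toReal_ofReal (hC.archKernelCDF_nonneg hψ t y)]
  refine ⟨K, inferInstance, ?_⟩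
  -- Only countably many `y` can share one null set; monotonicity and continuity in `y` supply the
  -- rest.
  have hq : ∀ᵐ t, ∀ q : Fin m → ℚ,
      (K t).real (Iic fun j => projIcc 0 1 zero_le_one (q j : ℝ)) =
        archKernelCDF C ψ t fun j => projIcc 0 1 zero_le_one (q j : ℝ) :=
    ae_all_iff.2 fun q => hy _
  filter_upwards [hq, unitInterval.ae_mem_Ioo] with t ht ht01
  refine congrFun (eq_of_monotone_of_continuous_of_rat (F := fun y => (K t).real (Iic y))
    (fun a b hab => measureReal_mono (Iic_subset_Iic.2 hab)) ?_ ht)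
  exact ((hψ.continuous_genDeriv_add_sum (hψ.pseudoInv_pos t.2 ht01.2)).div_const _).congr
    fun y => (hC.archKernelCDF_eq hψ ht01 y).symm

/-! ### The kernel at every level -/

lemma IsGenerator.continuous_genUnit {ψ : ℝ → ℝ} (h : IsGenerator ψ) : Continuous h.genUnit :=
  h.continuous_genExt.subtype_mk _

/-- Conditioning on one coordinate being large, and shifting it, turns the conditional law at level
`t` into the one at level `t + s`. -/
lemma IsConvexGenerator.exists_measure_shift {ψ : ℝ → ℝ} (h : IsConvexGenerator ψ) {m : ℕ}
    (i : Fin m) {t s : ℝ≥0∞} (ht : 0 < t) (hts : t + s < pseudoInv ψ 0) {ν : Measure (Fin m → I)}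
    [IsProbabilityMeasure ν]
    (hν : ∀ y, ν.real (Iic y) = genDeriv ψ (t + ∑ j, pseudoInv ψ (y j)) / genDeriv ψ t) :
    ∃ ν' : Measure (Fin m → I), IsProbabilityMeasure ν' ∧ ∀ y, ν'.real (Iic y) =
      genDeriv ψ (t + s + ∑ j, pseudoInv ψ (y j)) / genDeriv ψ (t + s) := by
  have hs0 : s < pseudoInv ψ 0 := le_add_self.trans_lt hts
  have hs_fin : s ≠ ∞ := hs0.ne_top
  have hdt : genDeriv ψ t < 0 := h.genDeriv_neg ht (le_self_add.trans_lt hts)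
  have hdts : genDeriv ψ (t + s) < 0 := h.genDeriv_neg (ht.trans_le le_self_add) hts
  -- Raising the `i`-th level by `r` raises the sum by `r`, provided it stays within `φ(0)`.
  have hsum : ∀ (y : Fin m → I) (r : ℝ≥0∞), pseudoInv ψ (y i) + r ≤ pseudoInv ψ 0 →
      ∑ j, pseudoInv ψ (Function.update y i (h.genUnit (pseudoInv ψ (y i) + r)) j) =
        r + ∑ j, pseudoInv ψ (y j) := by
    intro y r hr
    rw [← Finset.add_sum_erase _ _ (Finset.mem_univ i),
      ← Finset.add_sum_erase _ (fun j => pseudoInv ψ (y j)) (Finset.mem_univ i),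
      Function.update_self, h.coe_genUnit, h.pseudoInv_genExt_of_le hr, ← add_assoc,
      add_comm r]
    congr 1
    refine Finset.sum_congr rfl fun j hj => ?_
    rw [Function.update_of_ne (Finset.ne_of_mem_erase hj)]
  set S : Set (Fin m → I) := {u | u i ≤ h.genUnit s} with hS
  have hSm : MeasurableSet S := measurableSet_le (measurable_pi_apply i) measurable_const
  have hSmem : ∀ u : Fin m → I, u ∈ S ↔ s ≤ pseudoInv ψ (u i) := fun u =>
    h.le_genExt_iff (u i).2 hs0.le
  have hSν : ν.real S = genDeriv ψ (t + s) / genDeriv ψ t := by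
    have h0 : ∑ j : Fin m, pseudoInv ψ ((fun _ => 1 : Fin m → I) j) = 0 := by
      simp [h.pseudoInv_one]
    have h1 := hsum (fun _ => 1) s (by simpa [h.pseudoInv_one] using hs0.le)
    have h2 : S = Iic (Function.update (fun _ => 1) i
        (h.genUnit (pseudoInv ψ ((1 : I) : ℝ) + s))) := by
      ext u
      simp only [hS, mem_ofPred_eq, mem_Iic, le_update_iff, Icc.coe_one, h.pseudoInv_one, zero_add]
      exact ⟨fun hu => ⟨hu, fun j _ => unitInterval.le_one'⟩, fun hu => hu.1⟩
    rw [h2, hν, h1, h0, add_zero]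
  have hSpos : 0 < ν.real S := hSν ▸ div_pos_of_neg_of_neg hdts hdt
  have hSne : ν S ≠ 0 := fun h0 => hSpos.ne' (by rw [measureReal_def, h0, ENNReal.toReal_zero])
  have : IsProbabilityMeasure (ν[|S]) := cond_isProbabilityMeasure hSne
  -- On `S` the `i`-th level is at least `s`; `T` subtracts `s` from it.
  set T : (Fin m → I) → Fin m → I :=
    fun u => Function.update u i (h.genUnit (pseudoInv ψ (u i) - s)) with hT
  have hTm : Measurable T := by
    refine measurable_pi_iff.2 fun j => ?_
    by_cases hj : j = i
    · subst hj
      simp only [hT, Function.update_self]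
      exact h.continuous_genUnit.measurable.comp
        ((h.continuous_pseudoInv.measurable.comp (measurable_pi_apply j)).sub_const s)
    · simp only [hT, Function.update_of_ne hj]
      exact measurable_pi_apply j
  refine ⟨(ν[|S]).map T, Measure.isProbabilityMeasure_map hTm.aemeasurable, fun y => ?_⟩
  have hmem : ∀ u, u ∈ S ∩ T ⁻¹' Iic y ↔
      pseudoInv ψ (y i) + s ≤ pseudoInv ψ (u i) ∧ ∀ j, j ≠ i → u j ≤ y j := by
    intro u
    rw [mem_inter_iff, hSmem, mem_preimage, mem_Iic, hT, update_le_iff, ← and_assoc]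
    refine and_congr_left fun _ => ?_
    rw [← Subtype.coe_le_coe, h.coe_genUnit, h.genExt_le_iff (y i).2]
    constructor
    · rintro ⟨h1, h2⟩
      calc pseudoInv ψ (y i) + s ≤ pseudoInv ψ (u i) - s + s := by gcongr
        _ = pseudoInv ψ (u i) := tsub_add_cancel_of_le h1
    · intro h1
      exact ⟨le_add_self.trans h1, ENNReal.le_sub_of_add_le_right hs_fin h1⟩
  have hval : ν.real (S ∩ T ⁻¹' Iic y) =
      genDeriv ψ (t + s + ∑ j, pseudoInv ψ (y j)) / genDeriv ψ t := by
    rcases le_or_gt (pseudoInv ψ (y i) + s) (pseudoInv ψ 0) with hle | hgt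
    · have h1 : S ∩ T ⁻¹' Iic y =
          Iic (Function.update y i (h.genUnit (pseudoInv ψ (y i) + s))) := by
        ext u
        rw [hmem, mem_Iic, le_update_iff, ← Subtype.coe_le_coe, h.coe_genUnit,
          h.le_genExt_iff (u i).2 hle]
      rw [h1, hν, hsum y s hle, add_assoc]
    -- No point has a level beyond `φ(0)`, and the formula vanishes there too.
    · have h1 : S ∩ T ⁻¹' Iic y = ∅ := by
        refine eq_empty_of_forall_notMem fun u hu => ?_
        exact hgt.not_ge (((hmem u).1 hu).1.trans (h.pseudoInv_le (u i).2))
      have h2 : pseudoInv ψ (y i) ≤ ∑ j, pseudoInv ψ (y j) :=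
        Finset.single_le_sum (f := fun j => pseudoInv ψ (y j)) (fun _ _ => zero_le)
          (Finset.mem_univ i)
      have h3 : pseudoInv ψ 0 ≤ t + s + ∑ j, pseudoInv ψ (y j) := by
        calc pseudoInv ψ 0 ≤ pseudoInv ψ (y i) + s := hgt.le
          _ ≤ (∑ j, pseudoInv ψ (y j)) + s := by gcongr
          _ ≤ t + ((∑ j, pseudoInv ψ (y j)) + s) := le_add_self
          _ = t + s + ∑ j, pseudoInv ψ (y j) := by rw [add_comm (∑ j, _) s, add_assoc]
      rw [h1, measureReal_empty, h.genDeriv_eq_zero h3, zero_div]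
  rw [map_measureReal_apply hTm measurableSet_Iic, measureReal_def, cond_apply hSm, ENNReal.toReal_mul,
    ENNReal.toReal_inv, ← measureReal_def, ← measureReal_def, hval, hSν]
  field_simp [hdt.ne, hdts.ne]

lemma IsArchimedeanCopula.exists_measure_archKernelCDF {m : ℕ} (hm : 0 < m)
    {C : (Fin (m + 1) → I) → ℝ} {ψ : ℝ → ℝ} (hC : IsArchimedeanCopula C ψ)
    (hψ : IsConvexGenerator ψ) (x : I) :
    ∃ ν : Measure (Fin m → I), IsProbabilityMeasure ν ∧
      ∀ y, ν.real (Iic y) = archKernelCDF C ψ x y := by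
  by_cases hx : x = 0 ∨ x = 1
  · refine ⟨Measure.dirac 0, inferInstance, fun y => ?_⟩
    have h0 : (0 : Fin m → I) ∈ Iic y := fun j => unitInterval.nonneg'
    rw [archKernelCDF, if_pos hx, measureReal_def, Measure.dirac_apply_of_mem h0,
      ENNReal.toReal_one]
  · rw [not_or] at hx
    have hx01 : x ∈ Ioo (0 : I) 1 :=
      ⟨lt_of_le_of_ne unitInterval.nonneg' (Ne.symm hx.1), lt_of_le_of_ne unitInterval.le_one' hx.2⟩
    obtain ⟨K, hK, hKae⟩ := hC.exists_kernel_ae hψ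
    -- The good point must lie above `x`: the shift only increases levels, so it starts from a
    -- smaller `φ(x₀)`.
    have hne : NeBot (ae ((volume : Measure I).restrict (Ioo x 1))) := by
      rw [ae_neBot, Ne, Measure.restrict_eq_zero]
      simpa using hx01.2
    obtain ⟨x₀, hx₀, hx₀m⟩ := ((ae_restrict_of_ae hKae).and
      (ae_restrict_mem (μ := (volume : Measure I)) (s := Ioo x 1) measurableSet_Ioo)).exists
    have hx₀01 : x₀ ∈ Ioo (0 : I) 1 := ⟨hx01.1.trans hx₀m.1, hx₀m.2⟩
    have hle : pseudoInv ψ x₀ ≤ pseudoInv ψ x := hψ.pseudoInv_anti x.2 x₀.2 hx₀m.1.le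
    have hadd := add_tsub_cancel_of_le hle
    obtain ⟨ν, hν, hν'⟩ := hψ.exists_measure_shift (⟨0, hm⟩ : Fin m) (ν := K x₀)
      (t := pseudoInv ψ x₀) (s := pseudoInv ψ x - pseudoInv ψ x₀)
      (hψ.pseudoInv_pos x₀.2 hx₀m.2) (by rw [hadd]; exact hψ.pseudoInv_lt x.2 hx01.1)
      (fun y => by rw [hx₀, hC.archKernelCDF_eq hψ hx₀01])
    refine ⟨ν, hν, fun y => ?_⟩
    rw [hν', hadd, hC.archKernelCDF_eq hψ hx01]

/-- The distinguished version of the `1`-Markov kernel of an Archimedean copula exists. -/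
lemma IsArchimedeanCopula.exists_isArchKernel {m : ℕ} (hm : 0 < m)
    {C : (Fin (m + 1) → I) → ℝ} {ψ : ℝ → ℝ} (hC : IsArchimedeanCopula C ψ)
    (hψ : IsConvexGenerator ψ) : ∃ K : Kernel I (Fin m → I), IsArchKernel K C ψ := by
  choose ν hν hνC using hC.exists_measure_archKernelCDF hm hψ
  have hνI : ∀ x y, ν x (Iic y) = ENNReal.ofReal (archKernelCDF C ψ x y) := fun x y => by
    rw [← hνC, ofReal_measureReal]
  have hmeas : Measurable ν := by
    refine Measurable.measure_of_isPiSystem_of_isProbabilityMeasure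
      (MeasurableSpace.pi_eq_generateFrom_range_Iic m) isPiSystem_range_Iic ?_
    rintro _ ⟨y, rfl⟩
    simp_rw [hνI]
    exact (hC.measurable_archKernelCDF hψ y).ennreal_ofReal
  let K : Kernel I (Fin m → I) := ⟨ν, hmeas⟩
  have hK : IsMarkovKernel K := ⟨hν⟩
  obtain ⟨μ, hμ⟩ := hC.isCopula
  have := hμ.isProbabilityMeasure
  refine ⟨K, ⟨hK, μ, hμ, ⟨?_, ?_⟩⟩, hνC⟩
  · exact ((measurable_pi_apply 0).prodMk measurable_fin_tail).aemeasurable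
  · rw [hμ.map_eval 0]
    have : IsProbabilityMeasure (μ.map fun x => (x 0, (Fin.tail x : Fin m → I))) :=
      Measure.isProbabilityMeasure_map
        ((measurable_pi_apply 0).prodMk measurable_fin_tail).aemeasurable
    refine Measure.ext_of_Iic_prod fun x y => ?_
    rw [hμ.map_prod_apply, Measure.compProd_apply_prod measurableSet_Iic measurableSet_Iic,
      ← hC.setLIntegral_archKernelCDF hψ]
    exact lintegral_congr fun t => (hνI t y).symm

/-! ### Convergence of generators, pseudoinverses and derivatives -/

lemma IsGenerator.genExt_lt_genExt {ψ : ℝ → ℝ} (h : IsGenerator ψ) {a b : ℝ≥0∞} (hab : a < b)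
    (ha : a < pseudoInv ψ 0) : genExt ψ b < genExt ψ a := by
  rw [h.lt_genExt_iff (h.genExt_mem b), h.pseudoInv_genExt]
  exact lt_min hab ha

lemma IsArchimedeanCopula.continuous {d : ℕ} {C : (Fin d → I) → ℝ} {ψ : ℝ → ℝ}
    (hC : IsArchimedeanCopula C ψ) : Continuous C := by
  rw [funext hC.eq_gen]
  refine hC.isGenerator.continuous_genExt.comp (continuous_finsetSum _ fun i _ => ?_)
  exact hC.isGenerator.continuous_pseudoInv.comp (continuous_apply i)

lemma IsArchimedeanCopula.apply_cons_cons_one {k : ℕ} {C : (Fin (k + 2) → I) → ℝ} {ψ : ℝ → ℝ}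
    (hC : IsArchimedeanCopula C ψ) (x y : I) :
    C (Fin.cons x (Fin.cons y fun _ => 1)) = genExt ψ (pseudoInv ψ x + pseudoInv ψ y) := by
  rw [hC.apply_cons, Fin.sum_univ_succ]
  simp [hC.isGenerator.pseudoInv_one]

lemma IsArchimedeanCopula.apply_genUnit_genUnit {k : ℕ} {C : (Fin (k + 2) → I) → ℝ} {ψ : ℝ → ℝ}
    (hC : IsArchimedeanCopula C ψ) (a b : ℝ≥0∞) :
    C (Fin.cons (hC.isGenerator.genUnit a) (Fin.cons (hC.isGenerator.genUnit b) fun _ => 1)) =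
      genExt ψ (a + b) := by
  have h := hC.apply_genUnit (Fin.cons a (Fin.cons b 0))
  rw [Fin.sum_univ_succ, Fin.sum_univ_succ] at h
  simp only [Fin.cons_zero, Fin.cons_succ, Pi.zero_apply, Finset.sum_const_zero, add_zero] at h
  rw [← h]
  congr 1
  funext i
  refine Fin.cases rfl (fun i => ?_) i
  refine Fin.cases rfl (fun i => ?_) i
  simp [hC.isGenerator.genUnit_zero]

section Convergence

variable {k : ℕ} {C : (Fin (k + 2) → I) → ℝ} {Cn : ℕ → (Fin (k + 2) → I) → ℝ} {ψ : ℝ → ℝ}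
  {ψn : ℕ → ℝ → ℝ}

/-- Here `ψₙ(a + b) = Cₙ(ψₙ(a), ψₙ(b), 1, …, 1)`; uniform convergence to a continuous limit allows
the moving arguments. -/
lemma tendsto_genExt_add (hC : IsArchimedeanCopula C ψ)
    (hCn : ∀ n, IsArchimedeanCopula (Cn n) (ψn n)) (hconv : TendstoUniformly Cn C atTop)
    {a b : ℝ≥0∞} (ha : Tendsto (fun n => genExt (ψn n) a) atTop (𝓝 (genExt ψ a)))
    (hb : Tendsto (fun n => genExt (ψn n) b) atTop (𝓝 (genExt ψ b))) :
    Tendsto (fun n => genExt (ψn n) (a + b)) atTop (𝓝 (genExt ψ (a + b))) := by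
  simp_rw [← hC.apply_genUnit_genUnit, ← fun n => (hCn n).apply_genUnit_genUnit a b]
  refine hconv.tendsto_comp hC.continuous.continuousAt (tendsto_pi_nhds.2 fun i => ?_)
  refine Fin.cases ?_ (fun i => ?_) i
  · simp only [Fin.cons_zero]
    exact tendsto_subtype_rng.2 ha
  · refine Fin.cases ?_ (fun i => ?_) i
    · simp only [Fin.cons_zero, Fin.cons_succ]
      exact tendsto_subtype_rng.2 hb
    · simp only [Fin.cons_succ]
      exact tendsto_const_nhds

/-- Doubling of levels is inverted through the diagonal values `Cₙ(v, v, 1, …, 1) = ψₙ(2φₙ(v))`: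
comparing them with `ψₙ(2a)` decides on which side of `a` the level `φₙ(v)` lies. The bound on `a +
a` keeps the limiting comparison strict. -/
lemma tendsto_genExt_of_add_self (hC : IsArchimedeanCopula C ψ)
    (hCn : ∀ n, IsArchimedeanCopula (Cn n) (ψn n)) (hconv : TendstoUniformly Cn C atTop)
    {a : ℝ≥0∞} (ha0 : a + a < pseudoInv ψ 0)
    (ha : Tendsto (fun n => genExt (ψn n) (a + a)) atTop (𝓝 (genExt ψ (a + a)))) :
    Tendsto (fun n => genExt (ψn n) a) atTop (𝓝 (genExt ψ a)) := by
  have hψ := hC.isGenerator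
  have hψn := fun n => (hCn n).isGenerator
  have hlim : ∀ v : I, Tendsto (fun n => genExt (ψn n) (pseudoInv (ψn n) v + pseudoInv (ψn n) v))
      atTop (𝓝 (genExt ψ (pseudoInv ψ v + pseudoInv ψ v))) := fun v => by
    simp_rw [← hC.apply_cons_cons_one, ← fun n => (hCn n).apply_cons_cons_one v v]
    exact hconv.tendsto_at _
  rw [tendsto_order]
  constructor
  · intro v hv
    rcases lt_or_ge v 0 with hv0 | hv0
    · exact Eventually.of_forall fun n => hv0.trans_le ((hψn n).genExt_mem a).1
    have hvI : v ∈ Icc (0 : ℝ) 1 := ⟨hv0, hv.le.trans (hψ.genExt_mem a).2⟩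
    have h1 := (hψ.lt_genExt_iff hvI).1 hv
    have h2 := hψ.genExt_lt_genExt (ENNReal.add_lt_add h1 h1) ha0
    filter_upwards [(hlim ⟨v, hvI⟩).eventually_lt ha h2] with n hn
    rw [(hψn n).lt_genExt_iff hvI]
    by_contra! hle
    exact hn.not_ge ((hψn n).antitone_genExt (add_le_add hle hle))
  · intro v' hv'
    obtain ⟨v, hv, hvv'⟩ := exists_between hv'
    rcases lt_or_ge 1 v with hv1 | hv1
    · exact Eventually.of_forall fun n => (((hψn n).genExt_mem a).2.trans_lt hv1).trans hvv'
    have hvI : v ∈ Icc (0 : ℝ) 1 := ⟨(hψ.genExt_mem a).1.trans hv.le, hv1⟩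
    have h1 : pseudoInv ψ v < a := by
      rw [← not_le, ← hψ.le_genExt_iff hvI (le_self_add.trans ha0.le), not_le]
      exact hv
    have h3 := ENNReal.add_lt_add h1 h1
    have h2 := hψ.genExt_lt_genExt h3 (h3.trans ha0)
    filter_upwards [ha.eventually_lt (hlim ⟨v, hvI⟩) h2] with n hn
    refine lt_of_le_of_lt ?_ hvv'
    rw [(hψn n).genExt_le_iff hvI]
    by_contra! hlt
    exact hn.not_ge ((hψn n).antitone_genExt (add_le_add hlt.le hlt.le))

/-- The common value `ψ(1) = 1/2` anchors the scale; halving gives `2⁻ᵖ`, addition gives its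
multiples. -/
lemma tendsto_genExt_dyadic (hC : IsArchimedeanCopula C ψ)
    (hCn : ∀ n, IsArchimedeanCopula (Cn n) (ψn n)) (hconv : TendstoUniformly Cn C atTop)
    (p j : ℕ) : Tendsto (fun n => genExt (ψn n) (j * 2⁻¹ ^ p)) atTop
      (𝓝 (genExt ψ (j * 2⁻¹ ^ p))) := by
  have hψ := hC.isGenerator
  have hψn := fun n => (hCn n).isGenerator
  have hone : ∀ {f : ℝ → ℝ}, IsGenerator f → genExt f 1 = 1 / 2 := fun hf => by
    rw [← hf.pseudoInv_half, hf.genExt_pseudoInv (by norm_num)]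
  have h10 : 1 < pseudoInv ψ 0 := by
    rw [← hψ.lt_genExt_iff (by simp), hone hψ]
    norm_num
  have hp : Tendsto (fun n => genExt (ψn n) (2⁻¹ ^ p)) atTop (𝓝 (genExt ψ (2⁻¹ ^ p))) := by
    induction p with
    | zero => simp [hone hψ, fun n => hone (hψn n)]
    | succ p ih =>
      have h2 : (2⁻¹ : ℝ≥0∞) ^ (p + 1) + 2⁻¹ ^ (p + 1) = 2⁻¹ ^ p := by
        rw [pow_succ, ← mul_add, ENNReal.inv_two_add_inv_two, mul_one]
      refine tendsto_genExt_of_add_self hC hCn hconv ?_ (by rwa [h2])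
      rw [h2]
      exact (pow_le_one₀ zero_le (ENNReal.inv_le_one.2 (by norm_num))).trans_lt h10
  induction j with
  | zero => simp [hψ.genExt_zero, fun n => (hψn n).genExt_zero]
  | succ j ih =>
    push_cast
    rw [add_mul, one_mul]
    exact tendsto_genExt_add hC hCn hconv ih hp

/-- Convergence of Archimedean copulas implies pointwise convergence of the generators. -/
lemma tendsto_genExt (hC : IsArchimedeanCopula C ψ)
    (hCn : ∀ n, IsArchimedeanCopula (Cn n) (ψn n)) (hconv : TendstoUniformly Cn C atTop)
    (z : ℝ≥0∞) : Tendsto (fun n => genExt (ψn n) z) atTop (𝓝 (genExt ψ z)) := by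
  rcases eq_or_ne z ∞ with rfl | hz
  · simp [IsGenerator.genExt_top]
  have hψ := hC.isGenerator
  have hpow : Tendsto (fun p : ℕ => (2 : ℝ) ^ p) atTop atTop :=
    tendsto_pow_atTop_atTop_of_one_lt one_lt_two
  have hcoe : ∀ j p : ℕ, ENNReal.ofReal ((j : ℝ) / 2 ^ p) = j * 2⁻¹ ^ p := fun j p => by
    rw [ENNReal.ofReal_div_of_pos (by positivity), ENNReal.ofReal_natCast,
      ENNReal.ofReal_pow zero_le_two, div_eq_mul_inv, ENNReal.inv_pow]
    simp
  -- Dyadic points from above bound `ψₙ(z)` below, those from below bound it above; continuity of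
  -- `ψ` closes the gap.
  have hlim : ∀ j : ℕ → ℕ, Tendsto (fun p => (j p : ℝ) / 2 ^ p) atTop (𝓝 z.toReal) →
      Tendsto (fun p => genExt ψ (j p * 2⁻¹ ^ p)) atTop (𝓝 (genExt ψ z)) := fun j hj => by
    have := ENNReal.tendsto_ofReal hj
    rw [ENNReal.ofReal_toReal hz] at this
    simp_rw [hcoe] at this
    exact (hψ.continuous_genExt.tendsto z).comp this
  have hz0 : (0 : ℝ) ≤ z.toReal := ENNReal.toReal_nonneg
  rw [tendsto_order]
  constructor
  · intro v hv
    obtain ⟨p, hp⟩ := ((hlim (fun p => ⌈z.toReal * 2 ^ p⌉₊)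
      ((tendsto_nat_ceil_mul_div_atTop hz0).comp hpow)).eventually (lt_mem_nhds hv)).exists
    filter_upwards [(tendsto_genExt_dyadic hC hCn hconv p _).eventually (lt_mem_nhds hp)] with n hn
    refine hn.trans_le ((hCn n).isGenerator.antitone_genExt ?_)
    rw [← hcoe, ENNReal.le_ofReal_iff_toReal_le hz (by positivity), le_div_iff₀ (by positivity)]
    exact Nat.le_ceil _
  · intro v hv
    obtain ⟨p, hp⟩ := ((hlim (fun p => ⌊z.toReal * 2 ^ p⌋₊)
      ((tendsto_nat_floor_mul_div_atTop hz0).comp hpow)).eventually (gt_mem_nhds hv)).exists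
    filter_upwards [(tendsto_genExt_dyadic hC hCn hconv p _).eventually (gt_mem_nhds hp)] with n hn
    refine lt_of_le_of_lt ((hCn n).isGenerator.antitone_genExt ?_) hn
    rw [← hcoe, ENNReal.ofReal_le_iff_le_toReal hz, div_le_iff₀ (by positivity)]
    exact Nat.floor_le (by positivity)

end Convergence

section GeneratorConvergence

variable {ψ : ℝ → ℝ} {ψn : ℕ → ℝ → ℝ}

/-- Positivity of `x` matters: generators without a zero can converge to one with a zero, and then
`φₙ(0) = ∞` does not tend to `φ(0)`. -/
lemma tendsto_pseudoInv (hψ : IsGenerator ψ) (hψn : ∀ n, IsGenerator (ψn n))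
    (hlim : ∀ z, Tendsto (fun n => genExt (ψn n) z) atTop (𝓝 (genExt ψ z))) {x : ℝ}
    (hx : x ∈ Icc (0 : ℝ) 1) (hx0 : 0 < x) :
    Tendsto (fun n => pseudoInv (ψn n) x) atTop (𝓝 (pseudoInv ψ x)) := by
  rw [tendsto_order]
  constructor
  · intro r hr
    filter_upwards [(hlim r).eventually (lt_mem_nhds ((hψ.lt_genExt_iff hx).2 hr))] with n hn
    exact ((hψn n).lt_genExt_iff hx).1 hn
  · intro r' hr'
    obtain ⟨r, hr, hrr'⟩ := exists_between hr'
    have h1 := hψ.genExt_lt_genExt hr (hψ.pseudoInv_lt hx hx0)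
    rw [hψ.genExt_pseudoInv hx] at h1
    filter_upwards [(hlim r).eventually (gt_mem_nhds h1)] with n hn
    exact (((hψn n).genExt_le_iff hx).1 hn.le).trans_lt hrr'

lemma tendsto_genDeriv (hψ : IsConvexGenerator ψ) (hψn : ∀ n, IsConvexGenerator (ψn n))
    (hlim : ∀ z, Tendsto (fun n => genExt (ψn n) z) atTop (𝓝 (genExt ψ z))) {s : ℝ≥0∞}
    (hs0 : 0 < s) (hs : s ≠ ∞) {u : ℕ → ℝ≥0∞} (hu : Tendsto u atTop (𝓝 s)) :
    Tendsto (fun n => genDeriv (ψn n) (u n)) atTop (𝓝 (genDeriv ψ s)) := by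
  have h1 : Tendsto (fun n => deriv (ψn n) (u n).toReal) atTop (𝓝 (deriv ψ s.toReal)) := by
    have hspos := ENNReal.toReal_pos hs0.ne' hs
    refine tendsto_deriv_of_convexOn (S := Ioi 0) isOpen_Ioi
      (fun n => (hψn n).convexOn.subset Ioi_subset_Ici_self (convex_Ioi 0))
      (fun n => (hψn n).differentiableAt) (fun x hx => ?_) hspos (hψ.differentiableAt _ hspos)
      ((ENNReal.tendsto_toReal hs).comp hu)
    have := hlim (ENNReal.ofReal x)
    simpa only [IsGenerator.genExt_ofReal _ (le_of_lt (mem_Ioi.1 hx))] using this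
  rw [IsConvexGenerator.genDeriv_of_ne_top ψ hs]
  refine h1.congr' ?_
  filter_upwards [hu.eventually_mem (isOpen_ne.mem_nhds hs)] with n hn
  rw [IsConvexGenerator.genDeriv_of_ne_top _ hn]

end GeneratorConvergence

lemma IsConvexGenerator.genDeriv_add_sum_eq_zero {ψ : ℝ → ℝ} (h : IsConvexGenerator ψ) {m : ℕ}
    {y : Fin m → I} {j : Fin m} (hj : y j = 0) (t : ℝ≥0∞) :
    genDeriv ψ (t + ∑ j, pseudoInv ψ (y j)) = 0 := by
  refine h.genDeriv_eq_zero (le_add_left ?_)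
  have := Finset.single_le_sum (f := fun j => pseudoInv ψ (y j)) (fun _ _ => zero_le)
    (Finset.mem_univ j)
  simpa only [hj, Icc.coe_zero] using this

lemma tendsto_archKernelCDF {k : ℕ} {C : (Fin (k + 2) → I) → ℝ}
    {Cn : ℕ → (Fin (k + 2) → I) → ℝ} {ψ : ℝ → ℝ} {ψn : ℕ → ℝ → ℝ}
    (hC : IsArchimedeanCopula C ψ) (hCn : ∀ n, IsArchimedeanCopula (Cn n) (ψn n))
    (hψ : IsConvexGenerator ψ) (hψn : ∀ n, IsConvexGenerator (ψn n))
    (hconv : TendstoUniformly Cn C atTop) {x : I} (hx : x ∈ Ioo (0 : I) 1) (y : Fin (k + 1) → I) :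
    Tendsto (fun n => archKernelCDF (Cn n) (ψn n) x y) atTop (𝓝 (archKernelCDF C ψ x y)) := by
  rw [hC.archKernelCDF_eq hψ hx, funext fun n => (hCn n).archKernelCDF_eq (hψn n) hx y]
  -- A zero coordinate is separated because `φₙ(0)` need not converge; it forces every numerator to
  -- be `0`.
  by_cases hy : ∃ j, y j = 0
  · obtain ⟨j, hj⟩ := hy
    simp [hψ.genDeriv_add_sum_eq_zero hj, fun n => (hψn n).genDeriv_add_sum_eq_zero hj]
  push Not at hy
  have hy0 : ∀ j, (0 : ℝ) < y j := fun j => unitInterval.pos_iff_ne_zero.2 (hy j)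
  have hlim := tendsto_genExt hC hCn hconv
  have hφ := fun {x : ℝ} => tendsto_pseudoInv hψ.toIsGenerator
    (fun n => (hψn n).toIsGenerator) hlim (x := x)
  have hxpos : 0 < pseudoInv ψ x := hψ.pseudoInv_pos x.2 hx.2
  have hxtop : pseudoInv ψ x ≠ ∞ := hψ.pseudoInv_ne_top x.2 hx.1
  refine Tendsto.div (tendsto_genDeriv hψ hψn hlim (hxpos.trans_le le_self_add) ?_ ?_)
    (tendsto_genDeriv hψ hψn hlim hxpos hxtop (hφ x.2 hx.1)) ?_
  · exact ENNReal.add_ne_top.2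
      ⟨hxtop, ENNReal.sum_ne_top.2 fun j _ => hψ.pseudoInv_ne_top (y j).2 (hy0 j)⟩
  · exact (hφ x.2 hx.1).add (tendsto_finsetSum _ fun j _ => hφ (y j).2 (hy0 j))
  · exact (hψ.genDeriv_neg hxpos (hψ.pseudoInv_lt x.2 hx.1)).ne

theorem lemma4p2 (m : ℕ) (hm : 2 ≤ m)
    (C : (Fin (m + 1) → I) → ℝ) (Cn : ℕ → (Fin (m + 1) → I) → ℝ)
    (ψ : ℝ → ℝ) (ψn : ℕ → ℝ → ℝ)
    (hC : IsArchimedeanCopula C ψ) (hCn : ∀ n, IsArchimedeanCopula (Cn n) (ψn n))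
    (hconv : TendstoUniformly Cn C atTop) :
    ∃ (K : Kernel I (Fin m → I)) (Kn : ℕ → Kernel I (Fin m → I)),
      IsArchKernel K C ψ ∧ (∀ n, IsArchKernel (Kn n) (Cn n) (ψn n)) ∧
      ∀ x₁ : I, x₁ ∈ Ioo (0 : I) 1 → ∀ y : Fin m → I,
        Tendsto (fun n => (Kn n x₁).real (Iic y)) atTop (𝓝 ((K x₁).real (Iic y))) := by
  have hψ := hC.isConvexGenerator hm
  have hψn := fun n => (hCn n).isConvexGenerator hm
  obtain ⟨k, rfl⟩ := Nat.exists_eq_add_of_le' (one_le_two.trans hm)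
  obtain ⟨K, hK⟩ := hC.exists_isArchKernel k.succ_pos hψ
  choose Kn hKn using fun n => (hCn n).exists_isArchKernel k.succ_pos (hψn n)
  refine ⟨K, Kn, hK, hKn, fun x₁ hx₁ y => ?_⟩
  simp_rw [hK.real_Iic, fun n => (hKn n).real_Iic]
  exact tendsto_archKernelCDF hC hCn hψ hψn hconv hx₁ y
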